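/- Functions with values in $\mathbb{R}\cup\{+\infty\}$ are used with the convention $0\cdot(+\infty)=0$. A function $w:\mathbb{R}^{2\times2}\to\mathbb{R}\cup\{+\infty\}$ is called - *convex* if $w((1-t)F+tG)\le(1-t)w(F)+t\,w(G)$ for all $F,G\in\mathbb{R}^{2\times2}$, $t\in[0,1]$ (and likewise on any other real vector space); - *polyconvex* if $w(F)=P(F,\det F)$ for some convex $P:\mathbb{R}^{2\times2}\times\mathbb{R}\to\mathbb{R}\cup\{+\infty\}$; - *quasiconvex* if it is Borel measurable and $\int_\Omega w(F_0+\nabla\vartheta)\,dx\ge w(F_0)\,|\Omega|$ (the integral being well defined) for all bounded open $\Omega\subset\mathbb{R}^2$, all smooth $\vartheta:\Omega\to\mathbb{R}^2$ with compact support in $\Omega$, and all $F_0\in\mathbb{R}^{2\times2}$; - *rank-one convex* if $w((1-t)F+t(F+H))\le(1-t)w(F)+t\,w(F+H)$ for all $t\in[0,1]$ and $F,H\in\mathbb{R}^{2\times2}$ with $\operatorname{rank}H=1$. For $W:\mathrm{SL}(2)\to\mathbb{R}$ let $\widehat W:\mathbb{R}^{2\times2}\to\mathbb{R}\cup\{+\infty\}$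 be the extension of $W$ by $+\infty$ outside $\mathrm{SL}(2)$. The rank-one convex, polyconvex and convex envelopes $RW,PW,CW$ of $W$ are defined at $F\in\mathrm{SL}(2)$ as the supremum of $w(F)$ over all rank-one convex, polyconvex and convex $w:\mathbb{R}^{2\times2}\to\mathbb{R}\cup\{+\infty\}$, respectively, with $w\le\widehat W$ on $\mathbb{R}^{2\times2}$. The quasiconvex envelope $QW(F)$ is the supremum of $w(F)$ over all quasiconvex $w\le\widehat W$ that are bounded above on every compact subset of $\mathrm{SL}(2)$ (a condition that is automatic if $W$ itself is bounded above on compact sets, for example if $W$ is continuous). **Theorem.** Let $W:\mathrm{SL}(2)\to\mathbb{R}$ be objective and isotropic, i.e. $W(RF)=W(FR)=W(F)$ for all $F\in\mathrm{SL}(2)$, $R\in\mathrm{SO}(2)$, and bounded below. Then there are uniquely determined functions $\widetilde\varphi:\mathbb{R}\to\mathbb{R}$ and $\varphi:[0,\infty)\to\mathbb{R}$ with $$W(F)=\widetilde\varphi(\lambda_1-\lambda_2)=\varphi\Bigl(\lambda_{\max}-\frac1{\lambda_{\max}}\Bigr)$$ for all $F\in\mathrm{SL}(2)$ with singular values $\lambda_1,\lambda_2$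 (in either order), where $\lambda_{\max}=\max\{\lambda_1,\lambda_2\}$; and for all such $F$, $$RW(F)=QW(F)=PW(F)=CW(F)=C\widetilde\varphi(\lambda_1-\lambda_2)=C_m\varphi\Bigl(\lambda_{\max}-\frac1{\lambda_{\max}}\Bigr).$$ Here $C\widetilde\varphi(t)$ is the supremum of $f(t)$ over all convex $f:\mathbb{R}\to\mathbb{R}\cup\{+\infty\}$ with $f\le\widetilde\varphi$, and $C_m\varphi(t)$ is the supremum of $p(t)$ over all monotone increasing (i.e. nondecreasing) convex $p:[0,\infty)\to\mathbb{R}$ with $p\le\varphi$ on $[0,\infty)$. -/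

import Mathlib

open MeasureTheory Set
open scoped ContDiff

noncomputable section

namespace PlanarEnvelopes

/-- Real `2 × 2` matrices. -/
abbrev Mat2 : Type := Matrix (Fin 2) (Fin 2) ℝ

/-- The Euclidean plane. -/
abbrev Plane : Type := EuclideanSpace ℝ (Fin 2)

/-- The special linear group `SL(2)` over `ℝ`. -/
abbrev SL2 : Type := Matrix.SpecialLinearGroup (Fin 2) ℝ

/-! Functions with values in `ℝ ∪ {+∞}` are `EReal`-valued functions omitting the value `⊥`. -/

/-- Convexity of a function `f : E → ℝ ∪ {+∞}` on a real vector space.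
(In `EReal` one has `0 * ⊤ = 0`.) -/
def IsConvex {E : Type} [AddCommGroup E] [Module ℝ E] (f : E → EReal) : Prop :=
  (∀ x, f x ≠ ⊥) ∧ ∀ (x y : E) (t : ℝ), 0 ≤ t → t ≤ 1 →
    f ((1 - t) • x + t • y) ≤ ((1 - t : ℝ) : EReal) * f x + (t : EReal) * f y

/-- Rank-one convexity of a function `W : ℝ^{2×2} → ℝ ∪ {+∞}`. -/
def IsRankOneConvex (W : Mat2 → EReal) : Prop :=
  (∀ F, W F ≠ ⊥) ∧ ∀ (F H : Mat2) (t : ℝ), 0 ≤ t → t ≤ 1 → H.rank = 1 →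
    W ((1 - t) • F + t • (F + H)) ≤ ((1 - t : ℝ) : EReal) * W F + (t : EReal) * W (F + H)

/-- Polyconvexity of a function `W : ℝ^{2×2} → ℝ ∪ {+∞}`. -/
def IsPolyconvex (W : Mat2 → EReal) : Prop :=
  ∃ P : Mat2 × ℝ → EReal, IsConvex P ∧ ∀ F, W F = P (F, F.det)

/-- The gradient matrix `(∂ⱼ ϑᵢ)ᵢⱼ` of a vector field on the plane. -/
def grad (ϑ : Plane → Plane) (x : Plane) : Mat2 :=
  Matrix.of fun i j => (fderiv ℝ ϑ x (EuclideanSpace.single j 1)) i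

/-- The integral of an extended real valued function: integral of the positive part minus integral
of the negative part. If both are infinite, the value is `⊤ - ⊤ = ⊥` in `EReal`, so that an
undefined integral never satisfies a lower bound by a number in `ℝ ∪ {+∞}`. -/
def extIntegral (Ω : Set Plane) (g : Plane → EReal) : EReal :=
  ((∫⁻ x in Ω, (g x).toENNReal : ENNReal) : EReal) -
    ((∫⁻ x in Ω, (-(g x)).toENNReal : ENNReal) : EReal)

/-- Quasiconvexity of a (Borel measurable) function `W : ℝ^{2×2} → ℝ ∪ {+∞}`, with smooth
compactly supported test fields on arbitrary bounded open sets. -/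
def IsQuasiconvex (W : Mat2 → EReal) : Prop :=
  (∀ F, W F ≠ ⊥) ∧ Measurable[borel Mat2] W ∧
  ∀ (Ω : Set Plane), IsOpen Ω → Bornology.IsBounded Ω →
    ∀ ϑ : Plane → Plane, ContDiff ℝ ∞ ϑ → HasCompactSupport ϑ → tsupport ϑ ⊆ Ω →
      ∀ F₀ : Mat2,
        W F₀ * ((volume Ω : ENNReal) : EReal) ≤ extIntegral Ω (fun x => W (F₀ + grad ϑ x))

/-- `envelope P W` is the pointwise supremum of all functions below `W` with the property `P`. -/
def envelope {E : Type} (P : (E → EReal) → Prop) (W : E → EReal) (x : E) : EReal :=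
  sSup {v | ∃ w : E → EReal, P w ∧ (∀ y, w y ≤ W y) ∧ v = w x}

open Classical in
/-- The extension of `W : SL(2) → ℝ` by `+∞` to all of `ℝ^{2×2}`. -/
def extendByTop (W : SL2 → ℝ) (F : Mat2) : EReal :=
  if h : F.det = 1 then ((W ⟨F, h⟩ : ℝ) : EReal) else ⊤

/-- `w` is bounded above on every compact subset of `SL(2)`. -/
def BddAboveOnCompactsSL (w : Mat2 → EReal) : Prop :=
  ∀ K : Set Mat2, IsCompact K → (∀ F ∈ K, F.det = 1) → ∃ M : ℝ, ∀ F ∈ K, w F ≤ (M : EReal)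

/-- The rank-one convex envelope of `W : SL(2) → ℝ`. -/
def rankOneEnvelope (W : SL2 → ℝ) (F : SL2) : EReal :=
  envelope IsRankOneConvex (extendByTop W) F.val

/-- The quasiconvex envelope of `W : SL(2) → ℝ`. The competitors are bounded above on compact
subsets of `SL(2)`; this is automatic if `W` itself has this property, see
`quasiconvexEnvelope_eq`. -/
def quasiconvexEnvelope (W : SL2 → ℝ) (F : SL2) : EReal :=
  envelope (fun w => IsQuasiconvex w ∧ BddAboveOnCompactsSL w) (extendByTop W) F.val

/-- The polyconvex envelope of `W : SL(2) → ℝ`. -/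
def polyconvexEnvelope (W : SL2 → ℝ) (F : SL2) : EReal :=
  envelope IsPolyconvex (extendByTop W) F.val

/-- The convex envelope of `W : SL(2) → ℝ`. -/
def convexEnvelope (W : SL2 → ℝ) (F : SL2) : EReal :=
  envelope IsConvex (extendByTop W) F.val

/-- For `W` bounded above on compact subsets of `SL(2)`, the quasiconvex envelope is the supremum
over all quasiconvex functions below the extension of `W`. -/
theorem quasiconvexEnvelope_eq (W : SL2 → ℝ) (hW : BddAboveOnCompactsSL (extendByTop W)) (F : SL2) :
    quasiconvexEnvelope W F = envelope IsQuasiconvex (extendByTop W) F.val := by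
  unfold quasiconvexEnvelope envelope
  congr 1
  ext v
  constructor
  · rintro ⟨w, ⟨hw, -⟩, hle, rfl⟩
    exact ⟨w, hw, hle, rfl⟩
  · rintro ⟨w, hw, hle, rfl⟩
    refine ⟨w, ⟨hw, fun K hK hdet => ?_⟩, hle, rfl⟩
    obtain ⟨M, hM⟩ := hW K hK hdet
    exact ⟨M, fun G hG => (hle G).trans (hM G hG)⟩

/-- The convex envelope of a scalar function `f : ℝ → ℝ`. -/
def scalarConvexEnvelope (f : ℝ → ℝ) (t : ℝ) : EReal :=
  envelope IsConvex (fun s => ((f s : ℝ) : EReal)) t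

/-- The monotone-convex envelope of `φ : [0,∞) → ℝ`; only the values of `φ` and `p` on `[0,∞)`
are used. -/
def monotoneConvexEnvelope (φ : ℝ → ℝ) (t : ℝ) : EReal :=
  sSup {v | ∃ p : ℝ → ℝ, MonotoneOn p (Ici 0) ∧ ConvexOn ℝ (Ici 0) p ∧
    (∀ s ∈ Ici (0 : ℝ), p s ≤ φ s) ∧ v = ((p t : ℝ) : EReal)}

/-- `a, b` are the singular values of `F`, in any order and with multiplicity. -/
def HasSingularValues (F : Mat2) (a b : ℝ) : Prop :=
  ({a, b} : Multiset ℝ) =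
    {(Matrix.toEuclideanLin F).singularValues 0, (Matrix.toEuclideanLin F).singularValues 1}

/-- Left invariance under rotations. -/
def IsObjective (W : SL2 → ℝ) : Prop :=
  ∀ F R : SL2, R.val ∈ Matrix.specialOrthogonalGroup (Fin 2) ℝ → W (R * F) = W F

/-- Right invariance under rotations. -/
def IsIsotropic (W : SL2 → ℝ) : Prop :=
  ∀ F R : SL2, R.val ∈ Matrix.specialOrthogonalGroup (Fin 2) ℝ → W (F * R) = W F

/-- `W(F) = ψ(λ₁ - λ₂)` for all `F ∈ SL(2)` with singular values `λ₁, λ₂` (in any order). -/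
def RepresentsByDifference (W : SL2 → ℝ) (ψ : ℝ → ℝ) : Prop :=
  ∀ (F : SL2) (a b : ℝ), HasSingularValues F.val a b → W F = ψ (a - b)

/-- `W(F) = φ(λ_max - 1 / λ_max)` for all `F ∈ SL(2)`. -/
def RepresentsByMax (W : SL2 → ℝ) (φ : ℝ → ℝ) : Prop :=
  ∀ (F : SL2) (a b : ℝ), HasSingularValues F.val a b → W F = φ (max a b - 1 / max a b)

end PlanarEnvelopes

end

/-! Identify the plane with `ℂ` and write a matrix as `v ↦ α v + β v̄`. Rotations multiply `α` and
`β` by unimodular factors that can be prescribed independently, so on `SL(2)` an objective isotropic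
`W` depends only on `|β|`, and `2|β| = |λ₁ - λ₂|`. The shear `[[1, s], [0, 1]]` has `2|β| = |s|`.
Hence every `F ∈ SL(2)` with `(λ₁ - λ₂)² = s²` is `R * shear s * Q` with rotations `R, Q`, and both
scalar representatives are `t ↦ W (shear t)`.

Lower bound: `F ↦ 2β` is linear, so `p (2|β|)` is convex for every nondecreasing convex `p`. It is
therefore polyconvex and rank-one convex, and Jensen's inequality makes it quasiconvex; all four
envelopes dominate `C_m φ`.

Upper bound: the line `s ↦ R * shearMatrix s * Q` stays in `SL(2)` and has a rank-one direction. A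
rank-one convex `w ≤ Ŵ` restricts to a convex function below `t ↦ W (shear t)`, whence `RW ≤ C φ̃`.
Symmetrizing competitors gives `C φ̃ ≤ C_m φ`, closing the cycle.

The delicate case is a quasiconvex `w` that may be `+∞` off `SL(2)`: the usual laminates leave
`SL(2)` in their cut-off layers. Test maps are instead built from a generating function
(`exists_areaPreserving`), so all gradients have determinant one. They equal the two shears on most
of a rectangle and stay in a compact subset of `SL(2)` elsewhere, where `w` is bounded above
(`lamination_estimate`). -/

namespace PlanarEnvelopes

/-! ### Conformal splitting of matrices and reduction to shears -/

/-- The simple shear with parameter `s`. -/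
def shearMatrix (s : ℝ) : Mat2 := !![1, s; 0, 1]

theorem det_shearMatrix (s : ℝ) : (shearMatrix s).det = 1 := by
  simp [shearMatrix, Matrix.det_fin_two]

/-- The simple shear as an element of `SL(2)`. -/
def shear (s : ℝ) : SL2 := ⟨shearMatrix s, det_shearMatrix s⟩

/-- The matrix of the real linear map `v ↦ α v + β v̄` of the complex plane. -/
def complexMatrix (α β : ℂ) : Mat2 :=
  !![α.re + β.re, -α.im + β.im; α.im + β.im, α.re - β.re]

/-- The conformal part of a matrix. -/
noncomputable def conformalPart (F : Mat2) : ℂ := ⟨(F 0 0 + F 1 1) / 2, (F 1 0 - F 0 1) / 2⟩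

/-- Twice the anticonformal part of a matrix. -/
def anticonformalPart (F : Mat2) : ℂ := ⟨F 0 0 - F 1 1, F 0 1 + F 1 0⟩

theorem complexMatrix_parts (F : Mat2) :
    complexMatrix (conformalPart F) (anticonformalPart F / 2) = F := by
  ext i j
  fin_cases i <;> fin_cases j <;>
    simp [complexMatrix, conformalPart, anticonformalPart] <;> ring

/-- Conjugation passes `q` through `v̄` as `q̄`. This asymmetry lets two rotations adjust the phases
of `α` and `β` independently. -/
theorem complexMatrix_mul_mul (p q α β : ℂ) :
    complexMatrix p 0 * complexMatrix α β * complexMatrix q 0 =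
      complexMatrix (p * q * α) (p * (starRingEnd ℂ) q * β) := by
  ext i j
  fin_cases i <;> fin_cases j <;>
    simp [complexMatrix, Matrix.mul_apply, Fin.sum_univ_two] <;> ring

theorem complexMatrix_mem_specialOrthogonalGroup {p : ℂ} (hp : Complex.normSq p = 1) :
    complexMatrix p 0 ∈ Matrix.specialOrthogonalGroup (Fin 2) ℝ := by
  rw [Complex.normSq_apply] at hp
  rw [Matrix.mem_specialOrthogonalGroup_iff, Matrix.mem_orthogonalGroup_iff]
  constructor
  · ext i j
    fin_cases i <;> fin_cases j <;>
      simp [complexMatrix, Matrix.mul_apply, Fin.sum_univ_two] <;>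
      linarith
  · simp [complexMatrix, Matrix.det_fin_two]
    linarith

theorem normSq_anticonformalPart (F : Mat2) :
    Complex.normSq (anticonformalPart F) =
      F 0 0 ^ 2 + F 0 1 ^ 2 + F 1 0 ^ 2 + F 1 1 ^ 2 - 2 * F.det := by
  simp [anticonformalPart, Complex.normSq_apply, Matrix.det_fin_two]
  ring

theorem normSq_conformalPart (F : Mat2) :
    Complex.normSq (conformalPart F) = F.det + Complex.normSq (anticonformalPart F) / 4 := by
  simp [anticonformalPart, conformalPart, Complex.normSq_apply, Matrix.det_fin_two]
  ring

theorem exists_rotations {α β α' β' : ℂ} (hα : Complex.normSq α = Complex.normSq α')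
    (hβ : Complex.normSq β = Complex.normSq β') (h0 : Complex.normSq α' ≠ 0) :
    ∃ p q : ℂ, Complex.normSq p = 1 ∧ Complex.normSq q = 1 ∧
      α = p * q * α' ∧ β = p * (starRingEnd ℂ) q * β' := by
  obtain ⟨u, hu, hu'⟩ : ∃ u : ℂ, Complex.normSq u = 1 ∧ α = u * α' := by
    refine ⟨α / α', by rw [Complex.normSq_div, hα, div_self h0], ?_⟩
    rw [div_mul_cancel₀ _ (fun h => h0 (by simp [h]))]
  obtain ⟨v, hv, hv'⟩ : ∃ v : ℂ, Complex.normSq v = 1 ∧ β = v * β' := by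
    by_cases h : β' = 0
    · refine ⟨1, by simp, ?_⟩
      rw [h, map_zero, Complex.normSq_eq_zero] at hβ
      simp [h, hβ]
    · refine ⟨β / β', ?_, by rw [div_mul_cancel₀ _ h]⟩
      rw [Complex.normSq_div, hβ, div_self (by simpa using h)]
  -- For unimodular `q`, the equations `p q = u` and `p q̄ = v` force `p² = u v` and then `q = u
  -- p̄`.
  obtain ⟨p, hp⟩ := IsAlgClosed.exists_pow_nat_eq (u * v) (n := 2) (by norm_num)
  have hp1 : Complex.normSq p = 1 := by
    have h1 := congrArg Complex.normSq hp
    rw [map_pow, map_mul, hu, hv] at h1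
    have := Complex.normSq_nonneg p
    nlinarith
  have hpc : p * (starRingEnd ℂ) p = 1 := by rw [Complex.mul_conj, hp1]; simp
  have huc : u * (starRingEnd ℂ) u = 1 := by rw [Complex.mul_conj, hu]; simp
  refine ⟨p, u * (starRingEnd ℂ) p, hp1, by simp [hu, hp1], ?_, ?_⟩
  · rw [hu']
    linear_combination (-u * α') * hpc
  · rw [hv', map_mul, Complex.conj_conj]
    linear_combination (-(starRingEnd ℂ) u * β') * hp - v * β' * huc

/-- Every `F ∈ SL(2)` is a simple shear up to rotations. -/
theorem exists_eq_rotation_mul_shear_mul_rotation (F : SL2) {s : ℝ}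
    (hs : s ^ 2 = Complex.normSq (anticonformalPart F.val)) :
    ∃ R Q : SL2, R.val ∈ Matrix.specialOrthogonalGroup (Fin 2) ℝ ∧
      Q.val ∈ Matrix.specialOrthogonalGroup (Fin 2) ℝ ∧ F = R * shear s * Q := by
  have h1 : Complex.normSq (anticonformalPart (shearMatrix s)) = s ^ 2 := by
    simp [anticonformalPart, shearMatrix, Complex.normSq_apply, pow_two]
  have hdet := normSq_conformalPart F.val
  have hdet' := normSq_conformalPart (shearMatrix s)
  rw [F.2] at hdet
  rw [det_shearMatrix] at hdet'
  obtain ⟨p, q, hp, hq, hα, hβ⟩ := exists_rotations (α := conformalPart F.val)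
    (β := anticonformalPart F.val / 2) (α' := conformalPart (shearMatrix s))
    (β' := anticonformalPart (shearMatrix s) / 2) (by rw [hdet, hdet', h1, hs])
    (by rw [Complex.normSq_div, Complex.normSq_div, h1, hs])
    (by rw [hdet', h1]; positivity)
  have hP := complexMatrix_mem_specialOrthogonalGroup hp
  have hQ := complexMatrix_mem_specialOrthogonalGroup hq
  refine ⟨⟨_, (Matrix.mem_specialOrthogonalGroup_iff.1 hP).2⟩,
    ⟨_, (Matrix.mem_specialOrthogonalGroup_iff.1 hQ).2⟩, hP, hQ, ?_⟩
  apply Subtype.ext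
  change F.val = complexMatrix p 0 * shearMatrix s * complexMatrix q 0
  rw [← complexMatrix_parts (shearMatrix s), complexMatrix_mul_mul, ← hα, ← hβ,
    complexMatrix_parts]

/-! ### Singular values of matrices in `SL(2)` -/

theorem singularValues_sq_add_sq (F : Mat2) :
    (Matrix.toEuclideanLin F).singularValues 0 ^ 2 + (Matrix.toEuclideanLin F).singularValues 1 ^ 2
      = F 0 0 ^ 2 + F 0 1 ^ 2 + F 1 0 ^ 2 + F 1 1 ^ 2 := by
  set T := Matrix.toEuclideanLin F with hT
  have hn : Module.finrank ℝ (EuclideanSpace ℝ (Fin 2)) = 2 := finrank_euclideanSpace_fin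
  have h0 := T.sq_singularValues_fin hn 0
  have h1 := T.sq_singularValues_fin hn 1
  have h := T.isSymmetric_adjoint_comp_self.trace_eq_sum_eigenvalues hn
  rw [Fin.sum_univ_two] at h
  simp only [Fin.isValue, Fin.val_zero, Fin.val_one, RCLike.ofReal_real_eq_id, id] at h0 h1 h
  rw [h0, h1, ← h, hT, ← Matrix.toEuclideanLin_conjTranspose_eq_adjoint,
    Matrix.toEuclideanLin_eq_toLin_orthonormal, ← Matrix.toLin_mul, Matrix.trace_toLin_eq]
  simp [Matrix.trace_fin_two, Matrix.mul_apply, Fin.sum_univ_two]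
  ring

theorem singularValues_mul_sq (F : Mat2) :
    ((Matrix.toEuclideanLin F).singularValues 0 * (Matrix.toEuclideanLin F).singularValues 1) ^ 2
      = F.det ^ 2 := by
  set T := Matrix.toEuclideanLin F with hT
  have hn : Module.finrank ℝ (EuclideanSpace ℝ (Fin 2)) = 2 := finrank_euclideanSpace_fin
  have h0 := T.sq_singularValues_fin hn 0
  have h1 := T.sq_singularValues_fin hn 1
  have h := T.isSymmetric_adjoint_comp_self.det_eq_prod_eigenvalues hn
  rw [Fin.prod_univ_two] at h
  simp only [Fin.isValue, Fin.val_zero, Fin.val_one, RCLike.ofReal_real_eq_id, id] at h0 h1 h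
  rw [mul_pow, h0, h1, ← h, hT, ← Matrix.toEuclideanLin_conjTranspose_eq_adjoint,
    Matrix.toEuclideanLin_eq_toLin_orthonormal, ← Matrix.toLin_mul, LinearMap.det_toLin]
  simp [pow_two]

/-- The trace and determinant of `FᵀF` give `a² + b² = |F|²` and `(a b)² = 1`; nonnegativity selects
`a b = 1`, and subtracting `2 = 2 det F` completes the square. -/
theorem HasSingularValues.sub_sq {F : SL2} {a b : ℝ} (h : HasSingularValues F.val a b) :
    a * b = 1 ∧ 0 < a ∧ 0 < b ∧ (a - b) ^ 2 = Complex.normSq (anticonformalPart F.val) := by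
  set T := Matrix.toEuclideanLin F.val with hT
  have hadd := singularValues_sq_add_sq F.val
  have hmul := singularValues_mul_sq F.val
  have h0 := T.singularValues_nonneg 0
  have h1 := T.singularValues_nonneg 1
  rw [← hT] at hadd hmul
  rw [F.2] at hmul
  have hm : T.singularValues 0 * T.singularValues 1 = 1 := by
    have : 0 ≤ T.singularValues 0 * T.singularValues 1 := mul_nonneg h0 h1
    nlinarith
  have hab : (a = T.singularValues 0 ∧ b = T.singularValues 1) ∨
      (a = T.singularValues 1 ∧ b = T.singularValues 0) := by
    unfold HasSingularValues at h
    rw [← hT] at h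
    rw [Multiset.insert_eq_cons, Multiset.insert_eq_cons, Multiset.cons_eq_cons] at h
    rcases h with ⟨h, h'⟩ | ⟨-, c, h, h'⟩
    · exact Or.inl ⟨h, Multiset.singleton_inj.1 h'⟩
    · rw [Multiset.singleton_eq_cons_iff] at h h'
      exact Or.inr ⟨h'.1.symm, h.1⟩
  rw [normSq_anticonformalPart, F.2, ← hadd]
  have h0' : 0 < T.singularValues 0 := lt_of_le_of_ne h0 fun h => by rw [← h] at hm; simp at hm
  have h1' : 0 < T.singularValues 1 := lt_of_le_of_ne h1 fun h => by rw [← h] at hm; simp at hm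
  obtain ⟨rfl, rfl⟩ | ⟨rfl, rfl⟩ := hab
  · exact ⟨hm, h0', h1', by linear_combination (-2) * hm⟩
  · exact ⟨by rw [mul_comm]; exact hm, h1', h0', by linear_combination (-2) * hm⟩

theorem max_sub_one_div_max {a b : ℝ} (h : a * b = 1) (ha : 0 < a) (hb : 0 < b) :
    max a b - 1 / max a b = |a - b| := by
  have h1 : 1 / a = b := by field_simp; linarith
  have h2 : 1 / b = a := by field_simp; linarith
  rcases le_total a b with hab | hab
  · rw [max_eq_right hab, h2, abs_of_nonpos (by linarith)]; ring
  · rw [max_eq_left hab, h1, abs_of_nonneg (by linarith)]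

theorem exists_hasSingularValues_sub_eq {F : SL2} {s : ℝ}
    (hs : s ^ 2 = Complex.normSq (anticonformalPart F.val)) :
    ∃ a b, HasSingularValues F.val a b ∧ a - b = s := by
  set x := (Matrix.toEuclideanLin F.val).singularValues 0 with hx
  set y := (Matrix.toEuclideanLin F.val).singularValues 1 with hy
  have h1 : HasSingularValues F.val x y := rfl
  have h2 : HasSingularValues F.val y x := Multiset.pair_comm _ _
  rw [← h1.sub_sq.2.2.2] at hs
  rcases sq_eq_sq_iff_eq_or_eq_neg.1 hs with h | h
  · exact ⟨x, y, h1, h.symm⟩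
  · exact ⟨y, x, h2, by linarith⟩

theorem normSq_anticonformalPart_shear (s : ℝ) :
    s ^ 2 = Complex.normSq (anticonformalPart (shear s).val) := by
  simp [anticonformalPart, shear, shearMatrix, Complex.normSq_apply, pow_two]

/-! ### Convex, polyconvex and rank-one convex functions -/

theorem isConvex_coe {E : Type} [AddCommGroup E] [Module ℝ E] {f : E → ℝ}
    (hf : ConvexOn ℝ univ f) : IsConvex fun x => (f x : EReal) := by
  refine ⟨fun x => EReal.coe_ne_bot _, fun x y t h0 h1 => ?_⟩
  rw [← EReal.coe_mul, ← EReal.coe_mul, ← EReal.coe_add, EReal.coe_le_coe_iff]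
  exact hf.2 (mem_univ x) (mem_univ y) (by linarith) h0 (by ring)

theorem IsConvex.isPolyconvex {w : Mat2 → EReal} (hw : IsConvex w) : IsPolyconvex w :=
  ⟨fun p => w p.1, ⟨fun _ => hw.1 _, fun x y t h0 h1 => hw.2 x.1 y.1 t h0 h1⟩, fun _ => rfl⟩

/-- The determinant is affine along rank-one lines: the quadratic coefficient of `det (F + t H)` is
`det H = 0`. -/
theorem IsPolyconvex.isRankOneConvex {w : Mat2 → EReal} (hw : IsPolyconvex w) :
    IsRankOneConvex w := by
  obtain ⟨P, hP, hwP⟩ := hw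
  refine ⟨fun F => by rw [hwP]; exact hP.1 _, fun F H t h0 h1 hH => ?_⟩
  have hdet : H.det = 0 := by
    by_contra h
    rw [Matrix.rank_of_isUnit H ((Matrix.isUnit_iff_isUnit_det H).2 (isUnit_iff_ne_zero.2 h))] at hH
    simp at hH
  have h := hP.2 (F, F.det) (F + H, (F + H).det) t h0 h1
  rw [hwP, hwP, hwP]
  convert h using 2
  refine Prod.ext rfl ?_
  rw [Matrix.det_fin_two] at hdet
  simp [Matrix.det_fin_two]
  linear_combination (t ^ 2 - t) * hdet

/-! ### Monotone convex functions of the anticonformal seminorm -/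

/-- The convex seminorm `F ↦ |λ₁ - λ₂|` (for `det F ≥ 0`). -/
noncomputable def anticonformalNorm (F : Mat2) : ℝ := ‖anticonformalPart F‖

theorem anticonformalNorm_nonneg (F : Mat2) : 0 ≤ anticonformalNorm F := norm_nonneg _

theorem anticonformalPart_add (F G : Mat2) :
    anticonformalPart (F + G) = anticonformalPart F + anticonformalPart G := by
  apply Complex.ext <;> simp [anticonformalPart] <;> ring

theorem anticonformalPart_smul (c : ℝ) (F : Mat2) :
    anticonformalPart (c • F) = c • anticonformalPart F := by
  apply Complex.ext <;> simp [anticonformalPart] <;> ring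

theorem convexOn_anticonformalNorm : ConvexOn ℝ univ anticonformalNorm := by
  refine ⟨convex_univ, fun F _ G _ a b ha hb _ => ?_⟩
  unfold anticonformalNorm
  rw [anticonformalPart_add, anticonformalPart_smul, anticonformalPart_smul]
  refine (norm_add_le _ _).trans_eq ?_
  rw [norm_smul, norm_smul, Real.norm_of_nonneg ha, Real.norm_of_nonneg hb]
  rfl

theorem convexOn_comp_anticonformalNorm {p : ℝ → ℝ} (hm : MonotoneOn p (Ici 0))
    (hc : ConvexOn ℝ (Ici 0) p) : ConvexOn ℝ univ fun F => p (anticonformalNorm F) := by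
  refine ⟨convex_univ, fun F _ G _ a b ha hb hab => ?_⟩
  have h1 := convexOn_anticonformalNorm.2 (mem_univ F) (mem_univ G) ha hb hab
  have hF : anticonformalNorm F ∈ Ici (0 : ℝ) := anticonformalNorm_nonneg F
  have hG : anticonformalNorm G ∈ Ici (0 : ℝ) := anticonformalNorm_nonneg G
  exact (hm (anticonformalNorm_nonneg _) (hc.1 hF hG ha hb hab) h1).trans (hc.2 hF hG ha hb hab)

/-- A monotone convex function on the half line has, at every point of the half line, an affine
minorant with nonnegative slope. -/
theorem exists_nonneg_slope {p : ℝ → ℝ} (hm : MonotoneOn p (Ici 0))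
    (hc : ConvexOn ℝ (Ici 0) p) {t : ℝ} (ht : 0 ≤ t) :
    ∃ m : ℝ, 0 ≤ m ∧ ∀ s, 0 ≤ s → p t + m * (s - t) ≤ p s := by
  rcases ht.eq_or_lt with rfl | ht
  · exact ⟨0, le_rfl, fun s hs => by simpa using hm (mem_Ici.2 le_rfl) hs hs⟩
  -- The slope is the supremum of the left difference quotients. At `t = 0` there are none, and
  -- monotonicity allowed slope `0`.
  set S : Set ℝ := (fun s => (p t - p s) / (t - s)) '' Ico 0 t with hS
  have hub : ∀ u, t < u → ∀ x ∈ S, x ≤ (p u - p t) / (u - t) := by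
    rintro u hu _ ⟨s, hs, rfl⟩
    exact hc.slope_mono_adjacent hs.1 (ht.le.trans hu.le : (0 : ℝ) ≤ u) hs.2 hu
  have hbdd : BddAbove S := ⟨_, fun x hx => hub (t + 1) (by linarith) x hx⟩
  have hmem : ∀ s, 0 ≤ s → s < t → (p t - p s) / (t - s) ∈ S := fun s h0 h1 => ⟨s, ⟨h0, h1⟩, rfl⟩
  refine ⟨sSup S, ?_, fun s hs => ?_⟩
  · refine le_trans ?_ (le_csSup hbdd (hmem 0 le_rfl ht))
    have := hm (mem_Ici.2 le_rfl) (mem_Ici.2 ht.le) ht.le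
    exact div_nonneg (by linarith) (by linarith)
  · rcases lt_trichotomy s t with h | rfl | h
    · have := le_csSup hbdd (hmem s hs h)
      rw [div_le_iff₀ (by linarith)] at this
      linarith
    · simp
    · have := csSup_le ⟨_, hmem 0 le_rfl ht⟩ (hub s h)
      rw [le_div_iff₀ (by linarith)] at this
      linarith

/-! ### Comparison of the matrix envelopes with the scalar envelopes -/

theorem le_envelope {E : Type} {P : (E → EReal) → Prop} {W w : E → EReal} (hw : P w)
    (hle : ∀ y, w y ≤ W y) (x : E) : w x ≤ envelope P W x :=
  le_sSup ⟨w, hw, hle, rfl⟩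

theorem envelope_mono_prop {E : Type} {P Q : (E → EReal) → Prop} (h : ∀ w, P w → Q w)
    (W : E → EReal) (x : E) : envelope P W x ≤ envelope Q W x := by
  refine sSup_le ?_
  rintro _ ⟨w, hw, hle, rfl⟩
  exact le_envelope (h w hw) hle x

theorem extendByTop_coe (W : SL2 → ℝ) (F : SL2) : extendByTop W F.val = (W F : EReal) := by
  unfold extendByTop
  rw [dif_pos F.2]
  rfl

theorem rank_shear_direction (R Q : SL2) {c : ℝ} (hc : c ≠ 0) :
    (R.val * !![0, c; 0, 0] * Q.val).rank = 1 := by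
  rw [Matrix.rank_mul_eq_left_of_isUnit_det _ _ (by rw [Q.2]; exact isUnit_one),
    Matrix.rank_mul_eq_right_of_isUnit_det _ _ (by rw [R.2]; exact isUnit_one)]
  apply le_antisymm
  · have : (!![0, c; 0, 0] : Mat2) = Matrix.vecMulVec ![c, 0] ![0, 1] := by
      ext i j
      fin_cases i <;> fin_cases j <;> simp [Matrix.vecMulVec]
    rw [this]
    exact Matrix.rank_vecMulVec_le _ _
  · rw [Nat.one_le_iff_ne_zero, Ne, Matrix.rank, Submodule.finrank_eq_zero, LinearMap.range_eq_bot]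
    intro h
    have := congrFun (congrArg (fun f => f ![0, 1]) h) 0
    simp [hc] at this

/-- Convexity along the images of the shear line under rotations. -/
def ConvexAlongShears (w : Mat2 → EReal) : Prop :=
  ∀ (R Q : SL2), IsConvex fun s : ℝ => w (R.val * shearMatrix s * Q.val)

theorem IsRankOneConvex.convexAlongShears {w : Mat2 → EReal} (hw : IsRankOneConvex w) :
    ConvexAlongShears w := by
  refine fun R Q => ⟨fun s => hw.1 _, fun x y t h0 h1 => ?_⟩
  have key : ∀ c : ℝ, R.val * shearMatrix (x + c * (y - x)) * Q.val =
      R.val * shearMatrix x * Q.val + c • (R.val * !![0, y - x; 0, 0] * Q.val) := by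
    intro c
    rw [← Matrix.smul_mul, ← Matrix.mul_smul, ← Matrix.add_mul, ← Matrix.mul_add]
    congr 2
    ext i j
    fin_cases i <;> fin_cases j <;> simp [shearMatrix]
  -- For `y = x` the direction is zero, not of rank one. The claim is then `v ≤ (1 - t) v + t v`,
  -- where `v` may be `⊤`.
  by_cases hxy : y = x
  · subst hxy
    have h : (1 - t) • y + t • y = y := by simp only [smul_eq_mul]; ring
    simp only [h]
    rw [← EReal.right_distrib_of_nonneg (by exact_mod_cast sub_nonneg.2 h1)
      (by exact_mod_cast h0), ← EReal.coe_add]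
    simp
  · have h := hw.2 (R.val * shearMatrix x * Q.val) (R.val * !![0, y - x; 0, 0] * Q.val) t h0 h1
      (rank_shear_direction R Q (sub_ne_zero.2 hxy))
    have h2 := key 1
    rw [one_smul, one_mul, add_sub_cancel] at h2
    have h3 := key t
    rw [← h2] at h
    have h4 : (1 - t) • x + t • y = x + t * (y - x) := by simp only [smul_eq_mul]; ring
    have h5 : (1 - t) • (R.val * shearMatrix x * Q.val) + t • (R.val * shearMatrix y * Q.val) =
      R.val * shearMatrix (x + t * (y - x)) * Q.val := by
      rw [h2, h3]; module
    rw [h5] at h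
    simp only [h4]
    exact h

theorem eq_coe_of_le_extendByTop {W : SL2 → ℝ} {w : Mat2 → EReal} (hbot : ∀ F, w F ≠ ⊥)
    (hle : ∀ F, w F ≤ extendByTop W F) (F : SL2) : w F.val = ((w F.val).toReal : EReal) := by
  refine (EReal.coe_toReal (fun h => ?_) (hbot _)).symm
  have := hle F.val
  rw [extendByTop_coe, h, top_le_iff] at this
  exact EReal.coe_ne_top _ this

theorem apply_rotation_mul_shear_mul_rotation {W : SL2 → ℝ} (hobj : IsObjective W)
    (hiso : IsIsotropic W) {R Q : SL2} (hR : R.val ∈ Matrix.specialOrthogonalGroup (Fin 2) ℝ)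
    (hQ : Q.val ∈ Matrix.specialOrthogonalGroup (Fin 2) ℝ) (s : ℝ) :
    W (R * shear s * Q) = W (shear s) := by
  rw [hiso _ _ hQ, hobj _ _ hR]

theorem apply_eq_shear {W : SL2 → ℝ} (hobj : IsObjective W)
    (hiso : IsIsotropic W) {F : SL2} {s : ℝ}
    (hs : s ^ 2 = Complex.normSq (anticonformalPart F.val)) : W F = W (shear s) := by
  obtain ⟨R, Q, hR, hQ, h⟩ := exists_eq_rotation_mul_shear_mul_rotation F hs
  rw [h, apply_rotation_mul_shear_mul_rotation hobj hiso hR hQ]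

/-- With `F = R * shear s * Q` and `R, Q` frozen, `t ↦ w (R * shear t * Q)` is itself a competitor
for the scalar envelope, since invariance gives `W (R * shear t * Q) = W (shear t)`. -/
theorem apply_le_scalarConvexEnvelope {W : SL2 → ℝ} (hobj : IsObjective W) (hiso : IsIsotropic W)
    {w : Mat2 → EReal} (hle : ∀ F, w F ≤ extendByTop W F) (hw : ConvexAlongShears w) {F : SL2}
    {s : ℝ} (hs : s ^ 2 = Complex.normSq (anticonformalPart F.val)) :
    w F.val ≤ scalarConvexEnvelope (fun t => W (shear t)) s := by
  obtain ⟨R, Q, hR, hQ, h⟩ := exists_eq_rotation_mul_shear_mul_rotation F hs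
  have h1 : w F.val = w (R.val * shearMatrix s * Q.val) := by rw [h]; rfl
  rw [h1]
  refine le_envelope (E := ℝ) (w := fun s => w (R.val * shearMatrix s * Q.val)) (hw R Q)
    (fun t => ?_) s
  have h2 := hle (R * shear t * Q).val
  rw [extendByTop_coe, apply_rotation_mul_shear_mul_rotation hobj hiso hR hQ] at h2
  exact h2

theorem apply_shear_abs {W : SL2 → ℝ} (hobj : IsObjective W) (hiso : IsIsotropic W) (s : ℝ) :
    W (shear |s|) = W (shear s) :=
  (apply_eq_shear hobj hiso (by rw [sq_abs]; exact normSq_anticonformalPart_shear s)).symm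

theorem comp_anticonformalNorm_le {W : SL2 → ℝ} (hobj : IsObjective W) (hiso : IsIsotropic W)
    {p : ℝ → ℝ} (hp : ∀ s ∈ Ici (0 : ℝ), p s ≤ W (shear s)) (F : Mat2) :
    (p (anticonformalNorm F) : EReal) ≤ extendByTop W F := by
  unfold extendByTop
  split_ifs with h
  · rw [EReal.coe_le_coe_iff]
    refine (hp _ (anticonformalNorm_nonneg F)).trans_eq (apply_eq_shear hobj hiso ?_).symm
    rw [anticonformalNorm, Complex.normSq_eq_norm_sq]
  · exact le_top

theorem monotoneConvexEnvelope_le_envelope {W : SL2 → ℝ} (hobj : IsObjective W)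
    (hiso : IsIsotropic W) {P : (Mat2 → EReal) → Prop}
    (hP : ∀ p : ℝ → ℝ, MonotoneOn p (Ici 0) → ConvexOn ℝ (Ici 0) p →
      P fun F => (p (anticonformalNorm F) : EReal)) (F : Mat2) :
    monotoneConvexEnvelope (fun t => W (shear t)) (anticonformalNorm F) ≤
      envelope P (extendByTop W) F := by
  refine sSup_le ?_
  rintro _ ⟨p, hm, hc, hle, rfl⟩
  exact le_envelope (w := fun F => (p (anticonformalNorm F) : EReal)) (hP p hm hc)
    (comp_anticonformalNorm_le hobj hiso hle) F

/-- Replacing a competitor `g` by `max (g t) (g (-t))` only raises it and, `ψ` being even, keeps it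
below `ψ`. An even convex function is nondecreasing on `[0,∞)` because `x ∈ [-y, y]` whenever `0 ≤ x
≤ y`. -/
theorem scalarConvexEnvelope_le_monotoneConvexEnvelope {ψ : ℝ → ℝ} (hψ : ∀ s, ψ |s| = ψ s)
    (s : ℝ) : scalarConvexEnvelope ψ s ≤ monotoneConvexEnvelope ψ |s| := by
  refine sSup_le ?_
  rintro _ ⟨f, hf, hle, rfl⟩
  have hfin : ∀ t, f t = ((f t).toReal : EReal) := fun t =>
    (EReal.coe_toReal (fun h => by
      have := hle t
      rw [h, top_le_iff] at this
      exact EReal.coe_ne_top _ this) (hf.1 t)).symm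
  set g : ℝ → ℝ := fun t => (f t).toReal with hg
  have hgc : ConvexOn ℝ univ g := by
    refine ⟨convex_univ, fun x _ y _ a b ha hb hab => ?_⟩
    have h := hf.2 x y b hb (by linarith)
    have ha' : 1 - b = a := by linarith
    rw [hfin, hfin x, hfin y, ← EReal.coe_mul, ← EReal.coe_mul, ← EReal.coe_add,
      EReal.coe_le_coe_iff, ha'] at h
    exact h
  have hgψ : ∀ t, g t ≤ ψ t := fun t => by
    have := hle t
    rwa [hfin, EReal.coe_le_coe_iff] at this
  have hgn : ConvexOn ℝ univ fun t => g (-t) := by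
    have h := hgc.comp_linearMap (-LinearMap.id)
    rw [preimage_univ] at h
    exact h
  have hmax : ConvexOn ℝ univ fun t => max (g t) (g (-t)) := hgc.sup hgn
  have hmono : MonotoneOn (fun t => max (g t) (g (-t))) (Ici 0) := by
    intro x hx y hy hxy
    have hx' : (0 : ℝ) ≤ x := hx
    rcases hxy.eq_or_lt with rfl | hlt
    · exact le_rfl
    have h := hmax.le_max_of_mem_Icc (x := -y) (y := y) (z := x) (mem_univ _) (mem_univ _)
      ⟨by linarith, hxy⟩
    simp only [neg_neg] at h
    rw [max_comm (g (-y)), max_self] at h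
    exact h
  refine le_trans ?_ (le_sSup ⟨fun t => max (g t) (g (-t)), hmono,
    hmax.subset (subset_univ _) (convex_Ici 0), fun t _ => max_le (hgψ t) ?_, rfl⟩)
  · rw [hfin, EReal.coe_le_coe_iff]
    rcases abs_choice s with h | h <;> simp [h, hg]
  · refine (hgψ _).trans_eq ?_
    rw [← hψ, abs_neg, hψ]

/-! ### Jensen's inequality for functions of the anticonformal seminorm -/

/-- Positive parts grow, negative parts shrink, and subtraction in `EReal` respects both, so no
integrability is needed, even when one side is `⊤ - ⊤ = ⊥`. -/
theorem extIntegral_mono {Ω : Set Plane} (hΩ : MeasurableSet Ω) {g f : Plane → EReal}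
    (h : ∀ x ∈ Ω, g x ≤ f x) : extIntegral Ω g ≤ extIntegral Ω f := by
  refine EReal.sub_le_sub ?_ ?_ <;> rw [EReal.coe_ennreal_le_coe_ennreal_iff]
  · exact setLIntegral_mono' hΩ fun x hx => EReal.toENNReal_le_toENNReal (h x hx)
  · exact setLIntegral_mono' hΩ fun x hx =>
      EReal.toENNReal_le_toENNReal (EReal.neg_le_neg_iff.2 (h x hx))

theorem extIntegral_coe {Ω : Set Plane} {f : Plane → ℝ} (hf : IntegrableOn f Ω) :
    extIntegral Ω (fun x => (f x : EReal)) = ((∫ x in Ω, f x : ℝ) : EReal) := by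
  have hfin : ∀ g : Plane → ℝ, IntegrableOn g Ω → ∫⁻ x in Ω, ENNReal.ofReal (g x) ≠ ⊤ := by
    intro g hg
    refine ne_top_of_le_ne_top hg.2.ne (lintegral_mono fun x => ?_)
    rw [← ofReal_norm]
    exact ENNReal.ofReal_le_ofReal (le_abs_self _)
  rw [integral_eq_lintegral_pos_part_sub_lintegral_neg_part hf, EReal.coe_sub]
  unfold extIntegral
  simp only [← EReal.coe_neg, EReal.real_coe_toENNReal]
  rw [EReal.coe_ennreal_toReal (hfin f hf), EReal.coe_ennreal_toReal (hfin (fun x => -f x) hf.neg)]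

theorem grad_apply {ϑ : Plane → Plane} {x : Plane} (h : DifferentiableAt ℝ ϑ x) (i j : Fin 2) :
    grad ϑ x i j = fderiv ℝ (fun y => ϑ y i) x (EuclideanSpace.single j 1) := by
  have h2 := (EuclideanSpace.proj (𝕜 := ℝ) i : Plane →L[ℝ] ℝ).hasFDerivAt.comp x h.hasFDerivAt
  have h3 : fderiv ℝ (fun y => ϑ y i) x =
    (EuclideanSpace.proj (𝕜 := ℝ) i : Plane →L[ℝ] ℝ).comp (fderiv ℝ ϑ x) := h2.fderiv
  rw [h3]
  rfl

theorem integral_fderiv_apply_eq_zero {f : Plane → ℝ} (hf : ContDiff ℝ 1 f)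
    (hc : HasCompactSupport f) (v : Plane) :
    Integrable (fun x => fderiv ℝ f x v) ∧ ∫ x, fderiv ℝ f x v = 0 := by
  have hcont : Continuous fun x => fderiv ℝ f x v :=
    (hf.continuous_fderiv one_ne_zero).clm_apply continuous_const
  have hcs : HasCompactSupport fun x => fderiv ℝ f x v := hc.fderiv_apply (𝕜 := ℝ) v
  have hint := hcont.integrable_of_hasCompactSupport (μ := volume) hcs
  refine ⟨hint, ?_⟩
  -- Integration by parts against the constant function `1`.
  have := integral_mul_fderiv_eq_neg_fderiv_mul_of_integrable (μ := (volume : Measure Plane))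
    (f := fun _ => (1 : ℝ)) (g := f) (v := v) (by simp) (by simpa using hint)
    (by simpa using hf.continuous.integrable_of_hasCompactSupport hc)
    (fun x _ => differentiableAt_const _) (fun x _ => (hf.differentiable one_ne_zero) x)
  simpa using this

theorem integral_grad_eq_zero {ϑ : Plane → Plane} (hϑ : ContDiff ℝ ∞ ϑ)
    (hc : HasCompactSupport ϑ) {Ω : Set Plane} (hs : tsupport ϑ ⊆ Ω) (i j : Fin 2) :
    IntegrableOn (fun x => grad ϑ x i j) Ω ∧ ∫ x in Ω, grad ϑ x i j = 0 := by
  have hd : Differentiable ℝ ϑ := hϑ.differentiable (by simp)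
  have hi : ContDiff ℝ 1 fun y => ϑ y i :=
    ((EuclideanSpace.proj (𝕜 := ℝ) i : Plane →L[ℝ] ℝ).contDiff.comp hϑ).of_le (by simp)
  have hci : HasCompactSupport fun y => ϑ y i :=
    hc.comp_left (g := fun z : Plane => z i) rfl
  obtain ⟨h1, h2⟩ := integral_fderiv_apply_eq_zero hi hci (EuclideanSpace.single j 1)
  simp only [← grad_apply (hd _)] at h1 h2
  refine ⟨h1.integrableOn, ?_⟩
  rw [setIntegral_eq_integral_of_forall_compl_eq_zero, h2]
  intro x hx
  have hx' : x ∉ tsupport (fderiv ℝ ϑ) := fun h => hx (hs (tsupport_fderiv_subset ℝ h))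
  simp [grad, image_eq_zero_of_notMem_tsupport hx']

theorem anticonformalNorm_affine_minorant (F : Mat2) :
    ∃ c d : ℝ, ∀ G : Mat2, anticonformalNorm F + (c * (G 0 0 - G 1 1) + d * (G 0 1 + G 1 0)) ≤
      anticonformalNorm (F + G) := by
  set z := anticonformalPart F with hz
  -- The supporting functional of the norm at `z` is `Re (v̄ ·)`; for `z = 0` division by zero gives
  -- `v = 0`, which also works.
  set v : ℂ := z / ‖z‖ with hv
  have hv1 : ‖v‖ ≤ 1 := by
    rw [hv, norm_div, Complex.norm_real, norm_norm]
    exact div_self_le_one _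
  have hvz : ((starRingEnd ℂ) v * z).re = ‖z‖ := by
    by_cases h : z = 0
    · simp [h]
    · have h' : (‖z‖ : ℂ) ≠ 0 := by simpa using h
      have : (starRingEnd ℂ) v * z = ‖z‖ := by
        rw [hv, map_div₀, Complex.conj_ofReal]
        field_simp
        rw [mul_comm, Complex.mul_conj, Complex.normSq_eq_norm_sq]
        push_cast; rfl
      rw [this, Complex.ofReal_re]
  refine ⟨v.re, v.im, fun G => ?_⟩
  have h1 : ((starRingEnd ℂ) v * anticonformalPart (F + G)).re ≤ anticonformalNorm (F + G) := by
    refine (Complex.re_le_norm _).trans ?_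
    rw [norm_mul, RCLike.norm_conj]
    exact mul_le_of_le_one_left (norm_nonneg _) hv1
  rw [anticonformalPart_add, mul_add, Complex.add_re, ← hz, hvz] at h1
  refine le_trans (le_of_eq ?_) h1
  simp [anticonformalPart, anticonformalNorm, hz]

theorem continuous_anticonformalNorm : Continuous anticonformalNorm := by
  have : anticonformalNorm = fun F : Mat2 =>
      Real.sqrt ((F 0 0 - F 1 1) * (F 0 0 - F 1 1) + (F 0 1 + F 1 0) * (F 0 1 + F 1 0)) := by
    ext F
    rw [anticonformalNorm, Complex.norm_def, Complex.normSq_apply]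
    rfl
  rw [this]
  fun_prop

/-- A supporting line of `p` with slope `m ≥ 0`, composed with the affine minorant of the seminorm
at `F₀`, bounds the integrand below by a constant plus a linear expression in `∇ϑ`, whose integral
is zero. -/
theorem isQuasiconvex_comp_anticonformalNorm {p : ℝ → ℝ} (hm : MonotoneOn p (Ici 0))
    (hc : ConvexOn ℝ (Ici 0) p) :
    IsQuasiconvex fun F => (p (anticonformalNorm F) : EReal) := by
  refine ⟨fun F => EReal.coe_ne_bot _, ?_, ?_⟩
  · let _ : MeasurableSpace Mat2 := borel Mat2
    have : BorelSpace Mat2 := ⟨rfl⟩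
    -- Nothing is known about `p` on negative arguments; truncation gives a globally monotone, hence
    -- Borel, function.
    have hmono : Monotone fun t => p (max t 0) := fun x y hxy =>
      hm (le_max_right x 0) (le_max_right y 0) (max_le_max_right 0 hxy)
    have h := (hmono.measurable.comp continuous_anticonformalNorm.measurable).coe_real_ereal
    convert h using 2 with F
    simp [max_eq_left (anticonformalNorm_nonneg F)]
  · intro Ω hΩ hb ϑ hϑ hcs hs F₀
    obtain ⟨m, hm0, hslope⟩ := exists_nonneg_slope hm hc (anticonformalNorm_nonneg F₀)
    obtain ⟨c, d, hcd⟩ := anticonformalNorm_affine_minorant F₀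
    have hfin : volume Ω ≠ ⊤ := hb.measure_lt_top.ne
    have hI := fun i j => integral_grad_eq_zero hϑ hcs hs i j
    set f : Plane → ℝ := fun x => p (anticonformalNorm F₀) +
      m * (c * (grad ϑ x 0 0 - grad ϑ x 1 1) + d * (grad ϑ x 0 1 + grad ϑ x 1 0)) with hf
    have i1 : IntegrableOn (fun x => c * (grad ϑ x 0 0 - grad ϑ x 1 1)) Ω :=
      ((hI 0 0).1.sub (hI 1 1).1).const_mul c
    have i2 : IntegrableOn (fun x => d * (grad ϑ x 0 1 + grad ϑ x 1 0)) Ω :=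
      ((hI 0 1).1.add (hI 1 0).1).const_mul d
    have i3 : IntegrableOn (fun _ : Plane => p (anticonformalNorm F₀)) Ω :=
      integrableOn_const hfin
    have i4 : IntegrableOn (fun x => m * (c * (grad ϑ x 0 0 - grad ϑ x 1 1) +
      d * (grad ϑ x 0 1 + grad ϑ x 1 0))) Ω := (i1.add i2).const_mul m
    have hint : IntegrableOn f Ω := i3.add i4
    have e1 : ∫ x in Ω, c * (grad ϑ x 0 0 - grad ϑ x 1 1) = 0 := by
      rw [integral_const_mul, integral_sub (hI 0 0).1 (hI 1 1).1, (hI _ _).2, (hI _ _).2]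
      simp
    have e2 : ∫ x in Ω, d * (grad ϑ x 0 1 + grad ϑ x 1 0) = 0 := by
      rw [integral_const_mul, integral_add (hI 0 1).1 (hI 1 0).1, (hI _ _).2, (hI _ _).2]
      simp
    have hval : ∫ x in Ω, f x = p (anticonformalNorm F₀) * (volume Ω).toReal := by
      refine (integral_add i3 i4).trans ?_
      rw [integral_const_mul, integral_add i1 i2, e1, e2]
      simp [Measure.real, mul_comm]
    calc _ = ((∫ x in Ω, f x : ℝ) : EReal) := by
          rw [hval, EReal.coe_mul, EReal.coe_ennreal_toReal hfin]
      _ = extIntegral Ω fun x => (f x : EReal) := (extIntegral_coe hint).symm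
      _ ≤ _ := extIntegral_mono hΩ.measurableSet fun x _ => by
          rw [EReal.coe_le_coe_iff]
          refine le_trans ?_ (hslope _ (anticonformalNorm_nonneg _))
          rw [hf]
          have := mul_le_mul_of_nonneg_left (sub_le_sub_right (hcd (grad ϑ x))
            (anticonformalNorm F₀)) hm0
          rw [add_sub_cancel_left] at this
          linarith

theorem bddAboveOnCompactsSL_comp_anticonformalNorm {p : ℝ → ℝ} (hm : MonotoneOn p (Ici 0)) :
    BddAboveOnCompactsSL fun F => (p (anticonformalNorm F) : EReal) := by
  intro K hK _
  obtain ⟨C, hC⟩ := (hK.image continuous_anticonformalNorm).bddAbove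
  refine ⟨p (max C 0), fun F hF => ?_⟩
  rw [EReal.coe_le_coe_iff]
  exact hm (anticonformalNorm_nonneg F) (mem_Ici.2 (le_max_right _ _))
    ((hC (mem_image_of_mem _ hF)).trans (le_max_left _ _))

/-! ### One-dimensional cut-offs and lamination profiles -/

theorem hasDerivAt_primitive {f : ℝ → ℝ} (hf : Continuous f) (a x : ℝ) :
    HasDerivAt (fun y => ∫ t in a..y, f t) (f x) x :=
  intervalIntegral.integral_hasDerivAt_right (hf.intervalIntegrable _ _)
    hf.stronglyMeasurable.stronglyMeasurableAtFilter hf.continuousAt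

theorem contDiff_infty_of_hasDerivAt {f g : ℝ → ℝ} (hg : ContDiff ℝ ∞ g)
    (h : ∀ x, HasDerivAt f (g x) x) : ContDiff ℝ ∞ f := by
  rw [contDiff_infty_iff_deriv]
  refine ⟨fun x => (h x).differentiableAt, ?_⟩
  rwa [show deriv f = g from funext fun x => (h x).deriv]

/-- A smooth even cut-off function. -/
theorem exists_cutoff {δ : ℝ} (h0 : 0 < δ) (h1 : δ < 1) :
    ∃ χ : ℝ → ℝ, ContDiff ℝ ∞ χ ∧ (∀ x, 0 ≤ χ x) ∧ (∀ x, χ x ≤ 1) ∧ (∀ x, χ (-x) = χ x) ∧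
      (∀ x, |x| ≤ 1 - δ → χ x = 1) ∧ ∀ x, 1 ≤ |x| → χ x = 0 := by
  let b : ContDiffBump (0 : ℝ) := ⟨1 - δ, 1, by linarith, by linarith⟩
  refine ⟨b, b.contDiff, fun x => b.nonneg, fun x => b.le_one, fun x => b.neg x, fun x hx => ?_,
    fun x hx => ?_⟩
  · exact b.one_of_mem_closedBall (by simpa [Real.norm_eq_abs] using hx)
  · exact b.zero_of_le_dist (by simpa [Real.norm_eq_abs] using hx)

/-- The twice integrated lamination profile: its second derivative is mostly `(1 - μ) D` on a
proportion `μ` of `[-1,1]` and mostly `-μ D` on the rest. -/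
theorem exists_lamination_profile {χ : ℝ → ℝ} (hχ : ContDiff ℝ ∞ χ) (hneg : ∀ x, χ (-x) = χ x)
    (hzero : ∀ x, 1 ≤ |x| → χ x = 0) {μ : ℝ} (h0 : 0 < μ) (h1 : μ < 1) (D : ℝ) :
    ∃ H : ℝ → ℝ, ContDiff ℝ ∞ H ∧ (∀ y, 1 ≤ |y| → H y = 0) ∧
      ∀ y, deriv (deriv H) y = D * (χ (y / μ) - μ * χ y) := by
  set X : ℝ → ℝ := fun y => ∫ t in (0 : ℝ)..y, χ t with hX
  have hXd : ∀ y, HasDerivAt X (χ y) y := hasDerivAt_primitive hχ.continuous 0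
  have hXs : ContDiff ℝ ∞ X := contDiff_infty_of_hasDerivAt hχ hXd
  have hXneg : ∀ y, X (-y) = -X y := by
    intro y
    have := intervalIntegral.integral_comp_neg (a := 0) (b := y) χ
    simp only [hneg, neg_zero] at this
    rw [hX]
    simp only
    rw [intervalIntegral.integral_symm, ← this]
  have hXc : ∀ y, 1 ≤ y → X y = X 1 := by
    intro y hy
    rw [hX]
    simp only
    rw [← intervalIntegral.integral_add_adjacent_intervals (b := 1)
      (hχ.continuous.intervalIntegrable _ _) (hχ.continuous.intervalIntegrable _ _),
      add_eq_left]
    refine intervalIntegral.integral_zero_ae (Filter.Eventually.of_forall fun t ht => ?_)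
    rw [uIoc_of_le hy] at ht
    exact hzero t (ht.1.le.trans (le_abs_self t))
  -- The factor `μ` absorbs the `1 / μ` of the chain rule. For `y ≥ 1` both terms have reached `X 1`
  -- and cancel; oddness handles `y ≤ -1`.
  set h : ℝ → ℝ := fun y => D * μ * (X (y / μ) - X y) with hh
  have hhd : ∀ y, HasDerivAt h (D * (χ (y / μ) - μ * χ y)) y := by
    intro y
    have e0 : HasDerivAt (fun y => y / μ) (1 / μ) y := (hasDerivAt_id y).div_const μ
    have e1 : HasDerivAt (fun y => X (y / μ)) (χ (y / μ) * (1 / μ)) y :=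
      HasDerivAt.comp (h₂ := X) y (hXd (y / μ)) e0
    have e2 : D * μ * (χ (y / μ) * (1 / μ) - χ y) = D * (χ (y / μ) - μ * χ y) := by
      field_simp
    rw [← e2]
    exact (e1.sub (hXd y)).const_mul (D * μ)
  have hhs : ContDiff ℝ ∞ h :=
    contDiff_const.mul ((hXs.comp (contDiff_id.div_const μ)).sub hXs)
  have hhneg : ∀ y, h (-y) = -h y := by
    intro y
    simp only [hh, neg_div, hXneg]
    ring
  have hhpos : ∀ y, 1 ≤ y → h y = 0 := by
    intro y hy
    have : 1 ≤ y / μ := by rw [le_div_iff₀ h0]; nlinarith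
    simp only [hh]
    rw [hXc _ this, hXc _ hy]
    simp
  have hhzero : ∀ y, 1 ≤ |y| → h y = 0 := by
    intro y hy
    rcases le_abs.1 hy with hy | hy
    · exact hhpos y hy
    · rw [← neg_neg y, hhneg, hhpos _ hy, neg_zero]
  set H : ℝ → ℝ := fun y => ∫ t in (-1 : ℝ)..y, h t with hH
  have hHd : ∀ y, HasDerivAt H (h y) y := hasDerivAt_primitive hhs.continuous (-1)
  have hz : ∀ a b, (∀ t ∈ uIoc a b, 1 ≤ |t|) → ∫ t in a..b, h t = 0 := fun a b hab =>
    intervalIntegral.integral_zero_ae (Filter.Eventually.of_forall fun t ht => hhzero t (hab t ht))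
  -- Since `h` is odd, its integral over `[-1, 1]` vanishes, so `H` also returns to zero on the
  -- right.
  have hH1 : H 1 = 0 := by
    have := intervalIntegral.integral_comp_neg (a := -1) (b := 1) h
    simp only [hhneg, neg_neg, intervalIntegral.integral_neg] at this
    simp only [hH]
    linarith
  refine ⟨H, contDiff_infty_of_hasDerivAt hhs hHd, fun y hy => ?_, fun y => ?_⟩
  · rcases le_abs.1 hy with hy | hy
    · simp only [hH]
      rw [← intervalIntegral.integral_add_adjacent_intervals (b := 1)
        (hhs.continuous.intervalIntegrable _ _) (hhs.continuous.intervalIntegrable _ _)]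
      rw [hz 1 y, add_zero]
      · exact hH1
      · intro t ht
        rw [uIoc_of_le hy] at ht
        exact ht.1.le.trans (le_abs_self t)
    · refine hz _ _ fun t ht => ?_
      rw [uIoc_of_ge (by linarith)] at ht
      rw [le_abs]
      right
      linarith [ht.2]
  · rw [show deriv H = h from funext fun y => (hHd y).deriv]
    exact (hhd y).deriv

/-! ### Area preserving maps from a generating function -/

/-- The gradient of the area preserving map generated by `(x, Y) ↦ x Y + η(x) H(Y)`. -/
noncomputable def generatedGradient (q r t : ℝ) : Mat2 :=
  !![1 + r - q * t / (1 + r), t / (1 + r); -q / (1 + r), 1 / (1 + r)]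

theorem generatedGradient_shear (t : ℝ) : generatedGradient 0 0 t = shearMatrix t := by
  simp [generatedGradient, shearMatrix]

/-- The matrix is a quotient `DB * DA⁻¹` of Jacobian matrices, both of determinant `1 + r`, the
mixed derivative of the generating function. -/
theorem det_generatedGradient {q r t : ℝ} (hr : |r| ≤ 1 / 4) :
    (generatedGradient q r t).det = 1 := by
  have : 1 + r ≠ 0 := by have := abs_le.1 hr; linarith
  rw [generatedGradient, Matrix.det_fin_two_of]
  field_simp
  ring

theorem hasFDerivAt_apply_mul_apply {f g : ℝ → ℝ} {f' g' : ℝ} {p : Plane}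
    (hf : HasDerivAt f f' (p 0)) (hg : HasDerivAt g g' (p 1)) :
    HasFDerivAt (fun z : Plane => f (z 0) * g (z 1))
      ((f' * g (p 1)) • (EuclideanSpace.proj 0 : Plane →L[ℝ] ℝ) +
        (f (p 0) * g') • (EuclideanSpace.proj 1 : Plane →L[ℝ] ℝ)) p := by
  have h0 : HasFDerivAt (fun z : Plane => z 0) (EuclideanSpace.proj 0 : Plane →L[ℝ] ℝ) p :=
    (EuclideanSpace.proj 0 : Plane →L[ℝ] ℝ).hasFDerivAt
  have h1 : HasFDerivAt (fun z : Plane => z 1) (EuclideanSpace.proj 1 : Plane →L[ℝ] ℝ) p :=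
    (EuclideanSpace.proj 1 : Plane →L[ℝ] ℝ).hasFDerivAt
  have e : (f' * g (p 1)) • (EuclideanSpace.proj 0 : Plane →L[ℝ] ℝ) +
      (f (p 0) * g') • (EuclideanSpace.proj 1 : Plane →L[ℝ] ℝ) =
      f (p 0) • g' • (EuclideanSpace.proj 1 : Plane →L[ℝ] ℝ) +
        g (p 1) • f' • (EuclideanSpace.proj 0 : Plane →L[ℝ] ℝ) := by
    module
  rw [e]
  exact (hf.comp_hasFDerivAt p h0).mul (hg.comp_hasFDerivAt p h1)

theorem contDiff_apply_mul_apply {f g : ℝ → ℝ} (hf : ContDiff ℝ ∞ f) (hg : ContDiff ℝ ∞ g) :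
    ContDiff ℝ ∞ fun z : Plane => f (z 0) * g (z 1) :=
  (hf.comp (EuclideanSpace.proj 0 : Plane →L[ℝ] ℝ).contDiff).mul
    (hg.comp (EuclideanSpace.proj 1 : Plane →L[ℝ] ℝ).contDiff)

theorem norm_proj_le (i : Fin 2) : ‖(EuclideanSpace.proj i : Plane →L[ℝ] ℝ)‖ ≤ 1 :=
  ContinuousLinearMap.opNorm_le_bound _ zero_le_one fun x => by
    rw [one_mul]; exact PiLp.norm_apply_le x i

theorem hasFDerivAt_add_smul {q : Plane → ℝ} {ℓ : Plane →L[ℝ] ℝ} {p : Plane}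
    (h : HasFDerivAt q ℓ p) (v : Plane) :
    HasFDerivAt (fun z => z + q z • v) (ContinuousLinearMap.id ℝ Plane + ℓ.smulRight v) p :=
  (hasFDerivAt_id p).add (h.smul_const v)

/-- The rank-one perturbation `v ↦ v + ℓ(v) a` of the identity. -/
noncomputable def rankOnePerturbation (ℓ : Plane →L[ℝ] ℝ) (a : Plane) (h : 1 + ℓ a ≠ 0) :
    Plane ≃L[ℝ] Plane :=
  ContinuousLinearEquiv.equivOfInverse (ContinuousLinearMap.id ℝ Plane + ℓ.smulRight a)
    -- The Sherman–Morrison formula.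
    (ContinuousLinearMap.id ℝ Plane - (1 + ℓ a)⁻¹ • ℓ.smulRight a)
    (fun v => by
      simp only [add_apply, sub_apply, ContinuousLinearMap.id_apply, smul_apply,
        ContinuousLinearMap.smulRight_apply, map_add, map_smul]
      match_scalars <;> field_simp; ring)
    (fun v => by
      simp only [add_apply, sub_apply, ContinuousLinearMap.id_apply, smul_apply,
        ContinuousLinearMap.smulRight_apply, map_sub, map_smul]
      match_scalars <;> field_simp; ring)

/-- A map of the form `z ↦ z + q(z) a` with small smooth `q` is a diffeomorphism. -/
theorem exists_homeomorph_add_smul {q : Plane → ℝ} {ℓ : Plane → Plane →L[ℝ] ℝ}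
    (hq : ContDiff ℝ ∞ q) (hℓ : ∀ p, HasFDerivAt q (ℓ p) p) (hs : ∀ p, ‖ℓ p‖ ≤ 1 / 2) {a : Plane}
    (ha : ‖a‖ = 1) :
    ∃ A : Plane ≃ₜ Plane, (∀ z, A z = z + q z • a) ∧ ContDiff ℝ ∞ A.symm := by
  set f : Plane → Plane := fun z => z + q z • a with hf
  -- The perturbation `q a` is `1/2`-Lipschitz, so `f` is close enough to the identity to be a
  -- global homeomorphism.
  have hlip : ApproximatesLinearOn f
      ((ContinuousLinearEquiv.refl ℝ Plane : Plane ≃L[ℝ] Plane) : Plane →L[ℝ] Plane) univ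
      (1 / 2 : NNReal) := by
    intro x _ y _
    have h := convex_univ.norm_image_sub_le_of_norm_hasFDerivWithin_le (𝕜 := ℝ) (f := q) (f' := ℓ)
      (C := 1 / 2) (fun p _ => (hℓ p).hasFDerivWithinAt) (fun p _ => hs p) (mem_univ y)
      (mem_univ x)
    have e : f x - f y - ((ContinuousLinearEquiv.refl ℝ Plane : Plane ≃L[ℝ] Plane) :
        Plane →L[ℝ] Plane) (x - y) = (q x - q y) • a := by
      simp only [hf, ContinuousLinearEquiv.coe_refl, ContinuousLinearMap.id_apply]
      module
    rw [e, norm_smul, ha, mul_one]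
    simpa using h
  have hc : Subsingleton Plane ∨ (1 / 2 : NNReal) <
      ‖((ContinuousLinearEquiv.refl ℝ Plane).symm : Plane →L[ℝ] Plane)‖₊⁻¹ := by
    right
    have : ‖((ContinuousLinearEquiv.refl ℝ Plane).symm : Plane →L[ℝ] Plane)‖₊ = 1 := by
      simp
    rw [this, inv_one]
    exact NNReal.half_lt_self one_ne_zero
  set A := hlip.toHomeomorph f hc with hA
  have hAf : ∀ z, A z = z + q z • a := fun z => rfl
  refine ⟨A, hAf, ?_⟩
  have hne : ∀ p, 1 + ℓ p a ≠ 0 := fun p => by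
    have h1 : ‖ℓ p a‖ ≤ 1 / 2 := by
      refine ((ℓ p).le_opNorm a).trans ?_
      rw [ha, mul_one]
      exact hs p
    have := abs_le.1 h1
    intro h
    linarith
  refine Homeomorph.contDiff_symm A (f₀' := fun p => rankOnePerturbation (ℓ p) a (hne p))
    (fun p => ?_) ?_
  · exact hasFDerivAt_add_smul (hℓ p) a
  · exact contDiff_id.add (hq.smul contDiff_const)

theorem deriv_eq_zero_of_eqOn_const {f : ℝ → ℝ} {U : Set ℝ} (hU : IsOpen U) {c : ℝ}
    (h : ∀ x ∈ U, f x = c) {x : ℝ} (hx : x ∈ U) : deriv f x = 0 := by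
  have : f =ᶠ[nhds x] fun _ => c := Filter.eventuallyEq_of_mem (hU.mem_nhds hx) h
  rw [this.deriv_eq, deriv_const]

theorem grad_eq_of_comp_eq {Φ : Plane → Plane} {z : Plane} {q r t : ℝ} (hr : |r| ≤ 1 / 4)
    {DA DB : Plane →L[ℝ] Plane}
    (hcomp : (fderiv ℝ Φ z).comp DA = DB)
    (hA0 : DA (EuclideanSpace.single 0 1) =
      EuclideanSpace.single 0 1 + q • EuclideanSpace.single 1 1)
    (hA1 : DA (EuclideanSpace.single 1 1) = (1 + r) • EuclideanSpace.single 1 1)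
    (hB0 : DB (EuclideanSpace.single 0 1) = (1 + r) • EuclideanSpace.single 0 1)
    (hB1 : DB (EuclideanSpace.single 1 1) =
      EuclideanSpace.single 1 1 + t • EuclideanSpace.single 0 1) :
    grad Φ z = generatedGradient q r t := by
  have hr0 : 1 + r ≠ 0 := by have := abs_le.1 hr; linarith
  have h0 := congrArg (fun L : Plane →L[ℝ] Plane => L (EuclideanSpace.single 0 1)) hcomp
  have h1 := congrArg (fun L : Plane →L[ℝ] Plane => L (EuclideanSpace.single 1 1)) hcomp
  simp only [ContinuousLinearMap.comp_apply, hA0, hA1, hB0, hB1, map_add, map_smul] at h0 h1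
  have h00 := congrArg (fun v : Plane => v 0) h0
  have h01 := congrArg (fun v : Plane => v 1) h0
  have h10 := congrArg (fun v : Plane => v 0) h1
  have h11 := congrArg (fun v : Plane => v 1) h1
  simp at h00 h01 h10 h11
  have e10 : (fderiv ℝ Φ z (EuclideanSpace.single 1 1)) 0 = t / (1 + r) := by
    rw [eq_div_iff hr0]; linarith
  have e11 : (fderiv ℝ Φ z (EuclideanSpace.single 1 1)) 1 = 1 / (1 + r) := by
    rw [eq_div_iff hr0]; linarith
  rw [e10] at h00
  rw [e11] at h01
  ext i j
  fin_cases i <;> fin_cases j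
  · simp [grad, generatedGradient]
    linear_combination h00
  · simpa [grad, generatedGradient] using e10
  · simp [grad, generatedGradient]
    linear_combination h01
  · simpa [grad, generatedGradient] using e11

/-- A smooth area preserving perturbation of the identity, supported in a rectangle, which is the
shear `(x, y) ↦ (x + H'(y), y)` in the part of the rectangle where `η = 1`. -/
theorem exists_areaPreserving {η H : ℝ → ℝ} (hη : ContDiff ℝ ∞ η) (hH : ContDiff ℝ ∞ H)
    {n m T : ℝ} (hη0 : ∀ x, n < |x| → η x = 0) (hη1 : ∀ x, |x| < m → η x = 1)
    (hH0 : ∀ y, 1 < |y| → H y = 0) (hb1 : ∀ x y, |deriv (deriv η) x * H y| ≤ 1 / 4)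
    (hb2 : ∀ x y, |deriv η x * deriv H y| ≤ 1 / 4)
    (hT : ∀ x y, |η x * deriv (deriv H) y| ≤ T) :
    ∃ Φ : Plane → Plane, ContDiff ℝ ∞ Φ ∧ (∀ z : Plane, (n < |z 0| ∨ 1 < |z 1|) → Φ z = z) ∧
      (∀ z, ∃ q r t, |q| ≤ 1 / 4 ∧ |r| ≤ 1 / 4 ∧ |t| ≤ T ∧
        grad Φ z = generatedGradient q r t) ∧
      ∀ z : Plane, |z 0| < m → grad Φ z = shearMatrix (deriv (deriv H) (z 1)) := by
  have hη' : ContDiff ℝ ∞ (deriv η) := (contDiff_infty_iff_deriv.1 hη).2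
  have hH' : ContDiff ℝ ∞ (deriv H) := (contDiff_infty_iff_deriv.1 hH).2
  have dη : ∀ x, HasDerivAt η (deriv η x) x := fun x =>
    ((contDiff_infty_iff_deriv.1 hη).1 x).hasDerivAt
  have dη' : ∀ x, HasDerivAt (deriv η) (deriv (deriv η) x) x := fun x =>
    ((contDiff_infty_iff_deriv.1 hη').1 x).hasDerivAt
  have dH : ∀ x, HasDerivAt H (deriv H x) x := fun x =>
    ((contDiff_infty_iff_deriv.1 hH).1 x).hasDerivAt
  have dH' : ∀ x, HasDerivAt (deriv H) (deriv (deriv H) x) x := fun x =>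
    ((contDiff_infty_iff_deriv.1 hH').1 x).hasDerivAt
  have hU1 : IsOpen {x : ℝ | n < |x|} := isOpen_lt continuous_const continuous_abs
  have hU2 : IsOpen {x : ℝ | |x| < m} := isOpen_lt continuous_abs continuous_const
  have hU3 : IsOpen {x : ℝ | 1 < |x|} := isOpen_lt continuous_const continuous_abs
  have zη' : ∀ x, n < |x| → deriv η x = 0 := fun x hx => deriv_eq_zero_of_eqOn_const hU1 hη0 hx
  have oη' : ∀ x, |x| < m → deriv η x = 0 := fun x hx => deriv_eq_zero_of_eqOn_const hU2 hη1 hx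
  have oη'' : ∀ x, |x| < m → deriv (deriv η) x = 0 := fun x hx =>
    deriv_eq_zero_of_eqOn_const hU2 oη' hx
  have zH' : ∀ x, 1 < |x| → deriv H x = 0 := fun x hx => deriv_eq_zero_of_eqOn_const hU3 hH0 hx
  have hsm : ∀ p : Plane, ‖(deriv (deriv η) (p 0) * H (p 1)) •
      (EuclideanSpace.proj 0 : Plane →L[ℝ] ℝ) + (deriv η (p 0) * deriv H (p 1)) •
      (EuclideanSpace.proj 1 : Plane →L[ℝ] ℝ)‖ ≤ 1 / 2 := by
    intro p
    refine (norm_add_le _ _).trans ?_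
    rw [norm_smul, norm_smul, Real.norm_eq_abs, Real.norm_eq_abs]
    have h1 := mul_le_mul (hb1 (p 0) (p 1)) (norm_proj_le 0) (norm_nonneg _) (by norm_num)
    have h2 := mul_le_mul (hb2 (p 0) (p 1)) (norm_proj_le 1) (norm_nonneg _) (by norm_num)
    linarith
  obtain ⟨A, hA, hAs⟩ := exists_homeomorph_add_smul (contDiff_apply_mul_apply hη' hH)
    (fun p => hasFDerivAt_apply_mul_apply (dη' (p 0)) (dH (p 1))) hsm
    (a := EuclideanSpace.single 1 1) (by simp)
  -- For the generating function `S(x, Y) = x Y + η(x) H(Y)`, `A` sends `(x, Y)` to `(x, ∂S/∂x)` and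
  -- `B` sends it to `(∂S/∂Y, Y)`. The area preserving map is `B ∘ A⁻¹`.
  set B : Plane → Plane := fun z => z + (η (z 0) * deriv H (z 1)) • EuclideanSpace.single 0 1
    with hB
  have hBs : ContDiff ℝ ∞ B :=
    contDiff_id.add ((contDiff_apply_mul_apply hη hH').smul contDiff_const)
  have hΦs : ContDiff ℝ ∞ (B ∘ A.symm) := hBs.comp hAs
  have hfix : ∀ z : Plane, deriv η (z 0) * H (z 1) = 0 → A.symm z = z := by
    intro z hz
    rw [Homeomorph.symm_apply_eq, hA, hz, zero_smul, add_zero]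
  have hgrad : ∀ p : Plane, grad (B ∘ A.symm) (A p) = generatedGradient
      (deriv (deriv η) (p 0) * H (p 1)) (deriv η (p 0) * deriv H (p 1))
      (η (p 0) * deriv (deriv H) (p 1)) := by
    intro p
    have hdA := hasFDerivAt_add_smul (hasFDerivAt_apply_mul_apply (dη' (p 0)) (dH (p 1)))
      (EuclideanSpace.single 1 (1 : ℝ) : Plane)
    rw [← funext hA] at hdA
    have hdB : HasFDerivAt B _ p := hasFDerivAt_add_smul
      (hasFDerivAt_apply_mul_apply (dη (p 0)) (dH' (p 1))) (EuclideanSpace.single 0 1)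
    have hdΦ := ((hΦs.differentiable (by simp)) (A p)).hasFDerivAt.comp p hdA
    have hcomp : (B ∘ A.symm) ∘ A = B := by ext1 z; simp
    rw [hcomp] at hdΦ
    refine grad_eq_of_comp_eq (hb2 (p 0) (p 1)) (hdΦ.unique hdB) ?_ ?_ ?_ ?_
    · simp
    · simp; module
    · simp; module
    · simp
  refine ⟨B ∘ A.symm, hΦs, fun z hz => ?_, fun z => ?_, fun z hz => ?_⟩
  · have h1 : deriv η (z 0) * H (z 1) = 0 := by
      rcases hz with hz | hz
      · rw [zη' _ hz, zero_mul]
      · rw [hH0 _ hz, mul_zero]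
    have h2 : η (z 0) * deriv H (z 1) = 0 := by
      rcases hz with hz | hz
      · rw [hη0 _ hz, zero_mul]
      · rw [zH' _ hz, mul_zero]
    rw [Function.comp_apply, hfix z h1, hB]
    simp only [h2, zero_smul, add_zero]
  · have := hgrad (A.symm z)
    rw [Homeomorph.apply_symm_apply] at this
    exact ⟨_, _, _, hb1 _ _, hb2 _ _, hT _ _, this⟩
  -- Where `η = 1`, its derivatives vanish, `A` fixes the point, and only the entry `H''` survives.
  · have h1 : deriv η (z 0) * H (z 1) = 0 := by rw [oη' _ hz, zero_mul]
    have h2 : A z = z := by rw [hA, h1, zero_smul, add_zero]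
    have := hgrad z
    rwa [h2, oη'' _ hz, oη' _ hz, hη1 _ hz, zero_mul, zero_mul, one_mul,
      generatedGradient_shear] at this

/-! ### Linear changes of variables in the quasiconvexity inequality -/

/-- The integral inequality in the definition of quasiconvexity. -/
def JensenInequality (W : Mat2 → EReal) : Prop :=
  ∀ (Ω : Set Plane), IsOpen Ω → Bornology.IsBounded Ω →
    ∀ ϑ : Plane → Plane, ContDiff ℝ ∞ ϑ → HasCompactSupport ϑ → tsupport ϑ ⊆ Ω →
      ∀ F₀ : Mat2,
        W F₀ * ((volume Ω : ENNReal) : EReal) ≤ extIntegral Ω (fun x => W (F₀ + grad ϑ x))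

theorem grad_matrix_comp (A B : Mat2) {ϑ : Plane → Plane} (hϑ : Differentiable ℝ ϑ) (x : Plane) :
    grad (fun y => Matrix.toEuclideanCLM (n := Fin 2) (𝕜 := ℝ) A
      (ϑ (Matrix.toEuclideanCLM (n := Fin 2) (𝕜 := ℝ) B y))) x =
      A * grad ϑ (Matrix.toEuclideanCLM (n := Fin 2) (𝕜 := ℝ) B x) * B := by
  set TA := Matrix.toEuclideanCLM (n := Fin 2) (𝕜 := ℝ) A with hTA
  set TB := Matrix.toEuclideanCLM (n := Fin 2) (𝕜 := ℝ) B with hTB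
  have h : HasFDerivAt (fun y => TA (ϑ (TB y))) (TA.comp ((fderiv ℝ ϑ (TB x)).comp TB)) x :=
    TA.hasFDerivAt.comp x (((hϑ (TB x)).hasFDerivAt).comp x TB.hasFDerivAt)
  have hB : ∀ j, TB (EuclideanSpace.single j 1) =
      B 0 j • EuclideanSpace.single 0 1 + B 1 j • EuclideanSpace.single 1 1 := by
    intro j
    ext i
    rw [hTB, Matrix.ofLp_toEuclideanCLM]
    fin_cases i <;> simp
  ext i j
  simp only [grad, Matrix.of_apply, h.fderiv, ContinuousLinearMap.comp_apply, hB, map_add, map_smul]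
  rw [hTA]
  simp only [PiLp.add_apply, PiLp.smul_apply, Matrix.ofLp_toEuclideanCLM, Matrix.mul_apply,
    Fin.sum_univ_two, Matrix.mulVec, dotProduct, smul_eq_mul, Matrix.of_apply]
  ring

/-- The linear automorphism of the plane given by an element of `SL(2)`. -/
noncomputable def planeEquiv (B : SL2) : Plane ≃L[ℝ] Plane :=
  ContinuousLinearEquiv.equivOfInverse (Matrix.toEuclideanCLM (n := Fin 2) (𝕜 := ℝ) B.val)
    (Matrix.toEuclideanCLM (n := Fin 2) (𝕜 := ℝ) (B⁻¹).val)
    (fun v => by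
      rw [← mul_apply_eq_comp, ← map_mul, ← Matrix.SpecialLinearGroup.coe_mul,
        inv_mul_cancel, Matrix.SpecialLinearGroup.coe_one, map_one]
      rfl)
    (fun v => by
      rw [← mul_apply_eq_comp, ← map_mul, ← Matrix.SpecialLinearGroup.coe_mul,
        mul_inv_cancel, Matrix.SpecialLinearGroup.coe_one, map_one]
      rfl)

theorem planeEquiv_apply (B : SL2) (x : Plane) :
    planeEquiv B x = Matrix.toEuclideanCLM (n := Fin 2) (𝕜 := ℝ) B.val x := rfl

theorem measurePreserving_planeEquiv (B : SL2) :
    MeasurePreserving (planeEquiv B) volume volume := by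
  have hlin : LinearMap.det (Matrix.toEuclideanLin B.val) = 1 := by
    rw [Matrix.toEuclideanLin_eq_toLin_orthonormal, LinearMap.det_toLin, B.2]
  have h := Measure.map_linearMap_addHaar_eq_smul_addHaar (volume : Measure Plane)
    (f := Matrix.toEuclideanLin B.val) (by rw [hlin]; exact one_ne_zero)
  rw [hlin] at h
  refine ⟨(planeEquiv B).continuous.measurable, ?_⟩
  have e : (planeEquiv B : Plane → Plane) = Matrix.toEuclideanLin B.val := by
    ext x i
    rfl
  rw [e, h]
  simp

/-- The field `y ↦ A ϑ(B y)` on `B⁻¹ Ω` has gradient `A ∇ϑ(B y) B`, and `det B = 1` preserves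
volumes. This reduces lamination at an arbitrary point to lamination at the identity. -/
theorem JensenInequality.comp_mul {w : Mat2 → EReal} (hw : JensenInequality w) (A : Mat2)
    (B : SL2) : JensenInequality fun F => w (A * F * B.val) := by
  intro Ω hΩ hb ϑ hϑ hc hs F₀
  set e := planeEquiv B with he
  set TA := Matrix.toEuclideanCLM (n := Fin 2) (𝕜 := ℝ) A with hTA
  have hmp := measurePreserving_planeEquiv B
  have hemb : MeasurableEmbedding e := e.toHomeomorph.measurableEmbedding
  have hsub : tsupport (fun y => TA (ϑ (e y))) ⊆ e ⁻¹' tsupport ϑ := by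
    refine closure_minimal (fun y hy => subset_tsupport _ fun h => hy ?_)
      ((isClosed_tsupport ϑ).preimage e.continuous)
    change TA (ϑ (e y)) = 0
    rw [h, map_zero]
  have himg : e ⁻¹' Ω = e.symm '' Ω := (e.symm.toEquiv.image_eq_preimage_symm Ω).symm
  have h := hw (e ⁻¹' Ω) (hΩ.preimage e.continuous)
    (by rw [himg]; exact e.symm.lipschitz.isBounded_image hb) (fun y => TA (ϑ (e y)))
    (TA.contDiff.comp (hϑ.comp e.contDiff))
    ((e.toHomeomorph.isCompact_preimage.2 hc).of_isClosed_subset (isClosed_tsupport _) hsub)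
    (hsub.trans (preimage_mono hs)) (A * F₀ * B.val)
  rw [hmp.measure_preimage_emb hemb] at h
  refine h.trans_eq ?_
  have hg : ∀ x, w (A * F₀ * B.val + grad (fun y => TA (ϑ (e y))) x) =
      w (A * (F₀ + grad ϑ (e x)) * B.val) := by
    intro x
    have := grad_matrix_comp A B.val (hϑ.differentiable (by simp)) x
    rw [hTA]
    simp only [he, planeEquiv_apply]
    rw [this, Matrix.mul_add, Matrix.add_mul]
  unfold extIntegral
  simp only [hg]
  rw [hmp.setLIntegral_comp_preimage_emb hemb
      (fun y => (w (A * (F₀ + grad ϑ y) * B.val)).toENNReal),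
    hmp.setLIntegral_comp_preimage_emb hemb
      (fun y => (-w (A * (F₀ + grad ϑ y) * B.val)).toENNReal)]

theorem BddAboveOnCompactsSL.comp_mul {w : Mat2 → EReal} (hw : BddAboveOnCompactsSL w)
    (A B : SL2) : BddAboveOnCompactsSL fun F => w (A.val * F * B.val) := by
  intro K hK hdet
  have hcont : Continuous fun F : Mat2 => A.val * F * B.val := by fun_prop
  obtain ⟨M, hM⟩ := hw _ (hK.image hcont) (by
    rintro _ ⟨F, hF, rfl⟩
    simp only [Matrix.det_mul, A.2, B.2, hdet F hF, one_mul])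
  exact ⟨M, fun F hF => hM _ (mem_image_of_mem _ hF)⟩

theorem volume_plane_rectangle (I J : Set ℝ) :
    volume {z : Plane | z 0 ∈ I ∧ z 1 ∈ J} = volume I * volume J := by
  have h :=
    (EuclideanSpace.volume_preserving_symm_measurableEquiv_toLp (Fin 2)).measure_preimage_emb
      (MeasurableEquiv.measurableEmbedding _) (Set.univ.pi ![I, J])
  rw [volume_pi_pi, Fin.prod_univ_two] at h
  refine Eq.trans ?_ h
  congr 1
  ext z
  simp [Set.mem_pi, Fin.forall_fin_two]

/-- The parameter box has compact image in `SL(2)`. The resulting `M` controls the transition layers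
and depends only on `T`, not on the test map. -/
theorem exists_bound_generatedGradient {w : Mat2 → EReal} (hw : BddAboveOnCompactsSL w) (T : ℝ) :
    ∃ M : ℝ, ∀ q r t : ℝ, |q| ≤ 1 / 4 → |r| ≤ 1 / 4 → |t| ≤ T →
      w (generatedGradient q r t) ≤ (M : EReal) := by
  set S : Set (ℝ × ℝ × ℝ) :=
    Icc (-(1 / 4)) (1 / 4) ×ˢ (Icc (-(1 / 4)) (1 / 4) ×ˢ Icc (-T) T) with hS
  have hSc : IsCompact S := isCompact_Icc.prod (isCompact_Icc.prod isCompact_Icc)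
  have hne : ∀ x ∈ S, 1 + x.2.1 ≠ 0 := fun x hx => by
    have := hx.2.1.1
    intro h
    linarith
  have hcont : ContinuousOn (fun x : ℝ × ℝ × ℝ => generatedGradient x.1 x.2.1 x.2.2) S := by
    refine continuousOn_pi.2 fun i => continuousOn_pi.2 fun j => ?_
    fin_cases i <;> fin_cases j <;> simp only [generatedGradient, Fin.zero_eta, Fin.mk_one,
      Matrix.of_apply, Matrix.cons_val_zero, Matrix.cons_val_one] <;>
      fun_prop (disch := exact hne)
  obtain ⟨M, hM⟩ := hw _ (hSc.image_of_continuousOn hcont) (by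
    rintro _ ⟨x, hx, rfl⟩
    exact det_generatedGradient (abs_le.2 hx.2.1))
  exact ⟨M, fun q r t hq hr ht =>
    hM _ ⟨(q, r, t), ⟨abs_le.1 hq, abs_le.1 hr, abs_le.1 ht⟩, rfl⟩⟩

/-! ### Testing with smoothed laminates -/

theorem exists_abs_le_of_eq_zero {f : ℝ → ℝ} (hf : Continuous f)
    (h0 : ∀ x, 1 < |x| → f x = 0) : ∃ C, 0 ≤ C ∧ ∀ x, |f x| ≤ C := by
  have hc : HasCompactSupport f := HasCompactSupport.of_support_subset_isCompact
    (isCompact_Icc (a := (-1 : ℝ)) (b := 1)) fun x hx => by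
      by_contra h
      exact hx (h0 x (not_le.1 fun h' => h (abs_le.1 h')))
  obtain ⟨C, hC⟩ := hf.bounded_above_of_compact_support hc
  exact ⟨C, (norm_nonneg _).trans (hC 0), hC⟩

/-- A wide smooth cut-off function, so flat that its derivatives are small compared with `H`. -/
theorem exists_wide_cutoff {χ H : ℝ → ℝ} (hχ : ContDiff ℝ ∞ χ) (hzero : ∀ x, 1 ≤ |x| → χ x = 0)
    (hH : ContDiff ℝ ∞ H) (hH0 : ∀ y, 1 ≤ |y| → H y = 0) :
    ∃ n : ℝ, 0 < n ∧ (∀ x y, |deriv (deriv fun x => χ (x / n)) x * H y| ≤ 1 / 4) ∧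
      ∀ x y, |deriv (fun x => χ (x / n)) x * deriv H y| ≤ 1 / 4 := by
  have hU : IsOpen {x : ℝ | 1 < |x|} := isOpen_lt continuous_const continuous_abs
  have sχ' : ContDiff ℝ ∞ (deriv χ) := (contDiff_infty_iff_deriv.1 hχ).2
  have sχ'' : ContDiff ℝ ∞ (deriv (deriv χ)) := (contDiff_infty_iff_deriv.1 sχ').2
  have sH' : ContDiff ℝ ∞ (deriv H) := (contDiff_infty_iff_deriv.1 hH).2
  have zχ' : ∀ x, 1 < |x| → deriv χ x = 0 := fun x hx =>
    deriv_eq_zero_of_eqOn_const hU (fun x hx => hzero x (le_of_lt hx)) hx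
  have zχ'' : ∀ x, 1 < |x| → deriv (deriv χ) x = 0 := fun x hx =>
    deriv_eq_zero_of_eqOn_const hU zχ' hx
  have zH' : ∀ x, 1 < |x| → deriv H x = 0 := fun x hx =>
    deriv_eq_zero_of_eqOn_const hU (fun x hx => hH0 x (le_of_lt hx)) hx
  obtain ⟨C₁, h1, hC₁⟩ := exists_abs_le_of_eq_zero sχ'.continuous zχ'
  obtain ⟨C₂, h2, hC₂⟩ := exists_abs_le_of_eq_zero sχ''.continuous zχ''
  obtain ⟨K₀, h3, hK₀⟩ := exists_abs_le_of_eq_zero hH.continuous fun y hy => hH0 y hy.le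
  obtain ⟨K₁, h4, hK₁⟩ := exists_abs_le_of_eq_zero sH'.continuous zH'
  -- Each derivative of `χ (x / n)` gains a factor `1 / n`; the summand `1` ensures `n ≤ n²`, as
  -- needed for the second derivative.
  set n : ℝ := 1 + 4 * (C₂ * K₀ + C₁ * K₁) with hn
  have hA : 0 ≤ C₂ * K₀ := mul_nonneg h2 h3
  have hB : 0 ≤ C₁ * K₁ := mul_nonneg h1 h4
  have hn1 : 1 ≤ n := by linarith
  have hn0 : 0 < n := by linarith
  have d : ∀ f : ℝ → ℝ, ContDiff ℝ ∞ f → ∀ x, HasDerivAt (fun x => f (x / n))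
      (deriv f (x / n) / n) x := by
    intro f hf x
    have e0 : HasDerivAt (fun y => y / n) (1 / n) x := (hasDerivAt_id x).div_const n
    have e1 := HasDerivAt.comp (h₂ := f) x
      (((contDiff_infty_iff_deriv.1 hf).1 (x / n)).hasDerivAt) e0
    rw [mul_one_div] at e1
    exact e1
  have e1 : deriv (fun x => χ (x / n)) = fun x => deriv χ (x / n) / n :=
    funext fun x => (d χ hχ x).deriv
  have e2 : deriv (deriv fun x => χ (x / n)) = fun x => deriv (deriv χ) (x / n) / n / n := by
    rw [e1]
    exact funext fun x => ((d _ sχ' x).div_const n).deriv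
  refine ⟨n, hn0, fun x y => ?_, fun x y => ?_⟩
  · rw [e2]
    simp only
    rw [abs_mul, abs_div, abs_div, abs_of_pos hn0, div_div, div_mul_eq_mul_div,
      div_le_iff₀ (by positivity)]
    have := mul_le_mul (hC₂ (x / n)) (hK₀ y) (abs_nonneg _) h2
    nlinarith
  · rw [e1]
    simp only
    rw [abs_mul, abs_div, abs_of_pos hn0, div_mul_eq_mul_div, div_le_iff₀ hn0]
    have := mul_le_mul (hC₁ (x / n)) (hK₁ y) (abs_nonneg _) h1
    linarith

/-- The open rectangle `|x| < a`, `|y| < b`. -/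
def rectangle (a b : ℝ) : Set Plane := {z | z 0 ∈ Ioo (-a) a ∧ z 1 ∈ Ioo (-b) b}

theorem mem_rectangle {a b : ℝ} {z : Plane} : z ∈ rectangle a b ↔ |z 0| < a ∧ |z 1| < b := by
  simp only [rectangle, mem_ofPred_eq, mem_Ioo, abs_lt]

theorem isOpen_rectangle (a b : ℝ) : IsOpen (rectangle a b) :=
  (isOpen_Ioo.preimage (EuclideanSpace.proj 0 : Plane →L[ℝ] ℝ).continuous).inter
    (isOpen_Ioo.preimage (EuclideanSpace.proj 1 : Plane →L[ℝ] ℝ).continuous)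

theorem volume_rectangle (a b : ℝ) :
    volume (rectangle a b) = ENNReal.ofReal (2 * a) * ENNReal.ofReal (2 * b) := by
  rw [rectangle, volume_plane_rectangle, Real.volume_Ioo, Real.volume_Ioo]
  congr 2 <;> ring

theorem measureReal_rectangle {a b : ℝ} (ha : 0 ≤ a) (hb : 0 ≤ b) :
    volume.real (rectangle a b) = 4 * (a * b) := by
  rw [Measure.real, volume_rectangle, ENNReal.toReal_mul, ENNReal.toReal_ofReal (by positivity),
    ENNReal.toReal_ofReal (by positivity)]
  ring

theorem volume_rectangle_ne_top (a b : ℝ) : volume (rectangle a b) ≠ ⊤ := by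
  rw [volume_rectangle]
  exact ENNReal.mul_ne_top ENNReal.ofReal_ne_top ENNReal.ofReal_ne_top

theorem isBounded_rectangle (a b : ℝ) : Bornology.IsBounded (rectangle a b) := by
  refine isBounded_iff_forall_norm_le.2 ⟨|a| + |b|, fun z hz => ?_⟩
  rw [mem_rectangle] at hz
  rw [EuclideanSpace.norm_eq, Fin.sum_univ_two]
  refine Real.sqrt_le_iff.2 ⟨by positivity, ?_⟩
  have h1 : |z 0| ≤ |a| := hz.1.le.trans (le_abs_self a)
  have h2 : |z 1| ≤ |b| := hz.2.le.trans (le_abs_self b)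
  rw [Real.norm_eq_abs, Real.norm_eq_abs]
  nlinarith [abs_nonneg (z 0), abs_nonneg (z 1), abs_nonneg a, abs_nonneg b]

theorem grad_sub_id {Φ : Plane → Plane} {z : Plane} (h : DifferentiableAt ℝ Φ z) :
    1 + grad (fun y => Φ y - y) z = grad Φ z := by
  have : fderiv ℝ (fun y => Φ y - y) z = fderiv ℝ Φ z - ContinuousLinearMap.id ℝ Plane :=
    (h.hasFDerivAt.sub (hasFDerivAt_id z)).fderiv
  ext i j
  simp only [grad, this, Matrix.add_apply, Matrix.of_apply, sub_apply, PiLp.sub_apply,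
    ContinuousLinearMap.id_apply]
  fin_cases i <;> fin_cases j <;> simp

/-- The inequality obtained by testing with a smoothed laminate. -/
theorem lamination_estimate {w : Mat2 → EReal} (hw : JensenInequality w) {μ D M g g₁ g₂ : ℝ}
    (h0 : 0 < μ) (h1 : μ < 1)
    (hM : ∀ q r t : ℝ, |q| ≤ 1 / 4 → |r| ≤ 1 / 4 → |t| ≤ |D| →
      w (generatedGradient q r t) ≤ (M : EReal))
    (hg : w 1 = g) (hg₁ : w (shearMatrix (-(μ * D))) = g₁)
    (hg₂ : w (shearMatrix ((1 - μ) * D)) = g₂) {δ : ℝ} (hδ : 0 < δ) (hδμ : δ < 1 - μ) :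
    g * (1 + δ) ^ 2 ≤ M * (1 + δ) ^ 2 + (g₁ - M) * ((1 - δ) * (1 - δ) - (1 - δ) * μ) +
      (g₂ - M) * ((1 - δ) * (μ * (1 - δ))) := by
  obtain ⟨χ, hχ, hχ0, hχ1, hχneg, hχone, hχzero⟩ := exists_cutoff hδ (by linarith)
  obtain ⟨H, hH, hHzero, hH''⟩ := exists_lamination_profile hχ hχneg hχzero h0 h1 D
  obtain ⟨n, hn, hb1, hb2⟩ := exists_wide_cutoff hχ hχzero hH hHzero
  have hT : ∀ x y, |χ (x / n) * deriv (deriv H) y| ≤ |D| := by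
    intro x y
    rw [hH'', abs_mul, abs_mul, abs_of_nonneg (hχ0 _)]
    have : |χ (y / μ) - μ * χ y| ≤ 1 := by
      have := hχ0 (y / μ)
      have := hχ1 (y / μ)
      have := hχ0 y
      have := hχ1 y
      rw [abs_le]
      constructor <;> nlinarith
    calc _ ≤ 1 * (|D| * 1) := by
          have := hχ1 (x / n)
          gcongr
      _ = |D| := by ring
  obtain ⟨Φ, hΦ, hΦid, hΦgrad, hΦshear⟩ := exists_areaPreserving (η := fun x => χ (x / n))
    (hχ.comp (contDiff_id.div_const n)) hH (n := n) (m := n * (1 - δ))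
    (fun x hx => hχzero _ (by
      rw [abs_div, abs_of_pos hn, le_div_iff₀ hn]; linarith))
    (fun x hx => hχone _ (by
      rw [abs_div, abs_of_pos hn, div_le_iff₀ hn]; linarith))
    (fun y hy => hHzero y hy.le) hb1 hb2 hT
  have hδ1 : 0 < 1 - δ := by linarith
  -- The closed support lies in `[-n, n] × [-1, 1]`; the margin `δ` places it inside an open set.
  set Ω := rectangle (n * (1 + δ)) (1 + δ) with hΩ
  set E : ℝ → Set Plane := fun b => rectangle (n * (1 - δ)) b with hE
  have hsupp : tsupport (fun z => Φ z - z) ⊆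
      {z : Plane | z 0 ∈ Icc (-n) n ∧ z 1 ∈ Icc (-1) 1} := by
    refine closure_minimal (fun z hz => ?_)
      ((isClosed_Icc.preimage (EuclideanSpace.proj 0 : Plane →L[ℝ] ℝ).continuous).inter
        (isClosed_Icc.preimage (EuclideanSpace.proj 1 : Plane →L[ℝ] ℝ).continuous))
    by_contra h
    refine hz (sub_eq_zero.2 (hΦid z ?_))
    by_contra! h'
    exact h ⟨abs_le.1 h'.1, abs_le.1 h'.2⟩
  have hsΩ : tsupport (fun z => Φ z - z) ⊆ Ω := by
    refine hsupp.trans fun z hz => ⟨⟨?_, ?_⟩, ?_, ?_⟩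
    · have := hz.1.1; nlinarith
    · have := hz.1.2; nlinarith
    · have := hz.2.1; linarith
    · have := hz.2.2; linarith
  have hcs : HasCompactSupport fun z => Φ z - z :=
    Metric.isCompact_of_isClosed_isBounded (isClosed_tsupport _)
      ((isBounded_rectangle _ _).subset hsΩ)
  have key := hw Ω (isOpen_rectangle _ _) (isBounded_rectangle _ _) (fun z => Φ z - z)
    (hΦ.sub contDiff_id) hcs hsΩ 1
  simp only [grad_sub_id (hΦ.differentiable (by simp) _)] at key
  -- A step majorant. In the strip `|x| < n (1 - δ)` it is `g₂` for `|y| < μ (1 - δ)`, where `H'' =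
  -- (1 - μ) D`, and `g₁` for `μ ≤ |y| < 1 - δ`, where `H'' = -μ D`; it is `M` elsewhere.
  set f : Plane → ℝ := fun z => M + ((g₁ - M) * ((E (1 - δ)).indicator 1 z - (E μ).indicator 1 z) +
    (g₂ - M) * (E (μ * (1 - δ))).indicator 1 z) with hf
  have hle : ∀ z ∈ Ω, w (grad Φ z) ≤ (f z : EReal) := by
    intro z _
    have hgen : w (grad Φ z) ≤ (M : EReal) := by
      obtain ⟨q, r, t, hq, hr, ht, h⟩ := hΦgrad z
      rw [h]
      exact hM q r t hq hr ht
    have hμδ : μ * (1 - δ) < μ := by nlinarith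
    by_cases hz0 : |z 0| < n * (1 - δ)
    · have hmem : ∀ b, z ∈ E b ↔ |z 1| < b := fun b => by
        rw [hE]; simp only [mem_rectangle, hz0, true_and]
      by_cases ha : |z 1| < μ * (1 - δ)
      · have e : f z = g₂ := by
          simp only [hf, indicator, hmem, ha, ha.trans hμδ,
            (ha.trans hμδ).trans (by linarith : μ < 1 - δ), if_true, Pi.one_apply]
          ring
        rw [e, hΦshear z hz0, hH'', hχone (z 1 / μ), hχone (z 1), ← hg₂]
        · apply le_of_eq; congr 2; ring
        · nlinarith
        · rw [abs_div, abs_of_pos h0, div_le_iff₀ h0]; linarith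
      · by_cases hb : |z 1| < μ
        · have e : f z = M := by
            simp only [hf, indicator, hmem, ha, hb, hb.trans (by linarith : μ < 1 - δ), if_true,
              if_false, Pi.one_apply]
            ring
          rw [e]
          exact hgen
        · by_cases hc : |z 1| < 1 - δ
          · have e : f z = g₁ := by
              simp only [hf, indicator, hmem, ha, hb, hc, if_true, if_false, Pi.one_apply]
              ring
            rw [e, hΦshear z hz0, hH'', hχzero (z 1 / μ), hχone (z 1) hc.le, ← hg₁]
            · apply le_of_eq; congr 2; ring
            · rw [abs_div, abs_of_pos h0, le_div_iff₀ h0]; linarith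
          · have e : f z = M := by
              simp only [hf, indicator, hmem, ha, hb, hc, if_false]
              ring
            rw [e]
            exact hgen
    · have hmem : ∀ b, z ∉ E b := fun b h => hz0 (mem_rectangle.1 h).1
      have e : f z = M := by
        simp only [hf, indicator, hmem, if_false]
        ring
      rw [e]
      exact hgen
  have hEm : ∀ b, MeasurableSet (E b) := fun b => (isOpen_rectangle _ _).measurableSet
  have hΩfin : volume Ω ≠ ⊤ := volume_rectangle_ne_top _ _
  have hEi : ∀ b, IntegrableOn ((E b).indicator (1 : Plane → ℝ)) Ω := fun b =>
    (integrableOn_const (C := (1 : ℝ)) hΩfin).indicator (hEm b)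
  have hEint : ∀ b, 0 ≤ b → b ≤ 1 → ∫ z in Ω, (E b).indicator (1 : Plane → ℝ) z =
      4 * (n * (1 - δ) * b) := by
    intro b hb hb'
    have hsub : Ω ∩ E b = E b := by
      refine inter_eq_right.2 fun z hz => mem_rectangle.2 ?_
      have := mem_rectangle.1 hz
      exact ⟨by nlinarith [this.1], by linarith [this.2]⟩
    rw [setIntegral_indicator (hEm b), hsub]
    simp only [Pi.one_apply, integral_const, smul_eq_mul, mul_one, Measure.real,
      Measure.restrict_apply MeasurableSet.univ, univ_inter]
    exact measureReal_rectangle (by positivity) hb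
  have i1 : IntegrableOn (fun z => (g₁ - M) *
      ((E (1 - δ)).indicator 1 z - (E μ).indicator 1 z)) Ω :=
    ((hEi _).sub (hEi _)).const_mul _
  have i2 : IntegrableOn (fun z => (g₂ - M) * (E (μ * (1 - δ))).indicator 1 z) Ω :=
    (hEi _).const_mul _
  have i3 : IntegrableOn (fun _ : Plane => M) Ω := integrableOn_const hΩfin
  have i4 : IntegrableOn (fun z => (g₁ - M) * ((E (1 - δ)).indicator 1 z - (E μ).indicator 1 z) +
    (g₂ - M) * (E (μ * (1 - δ))).indicator 1 z) Ω := i1.add i2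
  have hfi : IntegrableOn f Ω := i3.add i4
  have hΩreal : volume.real Ω = 4 * (n * (1 + δ) * (1 + δ)) :=
    measureReal_rectangle (by positivity) (by positivity)
  have hval : ∫ z in Ω, f z = 4 * (n * (1 + δ) * (1 + δ)) * M +
      ((g₁ - M) * (4 * (n * (1 - δ) * (1 - δ)) - 4 * (n * (1 - δ) * μ)) +
        (g₂ - M) * (4 * (n * (1 - δ) * (μ * (1 - δ))))) := by
    refine (integral_add i3 i4).trans ?_
    rw [integral_add i1 i2, integral_const_mul, integral_const_mul,
      integral_sub (hEi _) (hEi _), hEint _ hδ1.le (by linarith), hEint _ h0.le h1.le,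
      hEint _ (by positivity) (by nlinarith), ← hΩreal]
    simp [Measure.real]
  have hfinal : ((g * (4 * (n * (1 + δ) * (1 + δ))) : ℝ) : EReal) ≤
      ((∫ z in Ω, f z : ℝ) : EReal) := by
    rw [← extIntegral_coe hfi, ← hΩreal, Measure.real, EReal.coe_mul,
      EReal.coe_ennreal_toReal hΩfin, ← hg]
    exact key.trans (extIntegral_mono (isOpen_rectangle _ _).measurableSet hle)
  rw [EReal.coe_le_coe_iff, hval] at hfinal
  -- The width `n`, which depends on `δ`, cancels from both sides; otherwise the limit `δ → 0` would
  -- not be available.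
  have h4n : 0 < 4 * n := by positivity
  refine le_of_mul_le_mul_left ?_ h4n
  linarith

/-- As `δ → 0` with `M` fixed, the total weight of `M` tends to `1 - (1 - μ) - μ = 0`. -/
theorem JensenInequality.shear_laminate {w : Mat2 → EReal} (hw : JensenInequality w)
    (hb : BddAboveOnCompactsSL w) {μ D g g₁ g₂ : ℝ} (h0 : 0 < μ) (h1 : μ < 1)
    (hg : w 1 = g) (hg₁ : w (shearMatrix (-(μ * D))) = g₁)
    (hg₂ : w (shearMatrix ((1 - μ) * D)) = g₂) :
    g ≤ (1 - μ) * g₁ + μ * g₂ := by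
  obtain ⟨M, hM⟩ := exists_bound_generatedGradient hb |D|
  have hl : Filter.Tendsto (fun δ : ℝ => g * (1 + δ) ^ 2) (nhdsWithin 0 (Ioi 0)) (nhds g) := by
    have : Continuous fun δ : ℝ => g * (1 + δ) ^ 2 := by fun_prop
    have h := this.tendsto 0
    simp only [add_zero, one_pow, mul_one] at h
    exact h.mono_left nhdsWithin_le_nhds
  have hr : Filter.Tendsto (fun δ : ℝ => M * (1 + δ) ^ 2 +
      (g₁ - M) * ((1 - δ) * (1 - δ) - (1 - δ) * μ) + (g₂ - M) * ((1 - δ) * (μ * (1 - δ))))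
      (nhdsWithin 0 (Ioi 0)) (nhds ((1 - μ) * g₁ + μ * g₂)) := by
    have : Continuous fun δ : ℝ => M * (1 + δ) ^ 2 +
      (g₁ - M) * ((1 - δ) * (1 - δ) - (1 - δ) * μ) + (g₂ - M) * ((1 - δ) * (μ * (1 - δ))) := by
      fun_prop
    have h := this.tendsto 0
    have e : M * (1 + (0 : ℝ)) ^ 2 + (g₁ - M) * ((1 - 0) * (1 - 0) - (1 - 0) * μ) +
        (g₂ - M) * ((1 - 0) * (μ * (1 - 0))) = (1 - μ) * g₁ + μ * g₂ := by ring
    rw [e] at h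
    exact h.mono_left nhdsWithin_le_nhds
  refine le_of_tendsto_of_tendsto hl hr ?_
  filter_upwards [Ioo_mem_nhdsGT (show (0 : ℝ) < 1 - μ by linarith)] with δ hδ
  exact lamination_estimate hw h0 h1 hM hg hg₁ hg₂ hδ.1 hδ.2

theorem shearMatrix_mul (s t : ℝ) : shearMatrix s * shearMatrix t = shearMatrix (s + t) := by
  ext i j
  fin_cases i <;> fin_cases j <;> simp [shearMatrix, add_comm]

theorem IsQuasiconvex.convexAlongShears {w : Mat2 → EReal} (hw : IsQuasiconvex w)
    (hb : BddAboveOnCompactsSL w) (hfin : ∀ F : SL2, w F.val = ((w F.val).toReal : EReal)) :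
    ConvexAlongShears w := by
  refine fun R Q => ⟨fun s => hw.1 _, fun x y t h0 h1 => ?_⟩
  rcases h0.eq_or_lt with rfl | h0
  · simp
  rcases h1.eq_or_lt with rfl | h1
  · simp
  have hf : ∀ s, w (R.val * shearMatrix s * Q.val) =
      ((w (R.val * shearMatrix s * Q.val)).toReal : EReal) := fun s => hfin (R * shear s * Q)
  set s := (1 - t) • x + t • y with hs
  -- Recentering at the intermediate shear `s` turns the two endpoints into shears by `-t (y - x)`
  -- and `(1 - t) (y - x)` around the identity.
  have hj : JensenInequality fun F => w ((R * shear s).val * F * Q.val) :=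
    JensenInequality.comp_mul hw.2.2 _ Q
  have hm : ∀ a, (R * shear s).val * shearMatrix a * Q.val =
      R.val * shearMatrix (s + a) * Q.val := fun a => by
    rw [← shearMatrix_mul, ← Matrix.mul_assoc R.val]
    rfl
  have hx : s + -(t * (y - x)) = x := by rw [hs]; simp only [smul_eq_mul]; ring
  have hy : s + (1 - t) * (y - x) = y := by rw [hs]; simp only [smul_eq_mul]; ring
  have h := hj.shear_laminate (hb.comp_mul _ Q) (D := y - x) h0 h1
    (g := (w (R.val * shearMatrix s * Q.val)).toReal)
    (g₁ := (w (R.val * shearMatrix x * Q.val)).toReal)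
    (g₂ := (w (R.val * shearMatrix y * Q.val)).toReal)
    (by rw [← hf, Matrix.mul_one]; rfl) (by simp only [hm, hx]; exact hf x)
    (by simp only [hm, hy]; exact hf y)
  beta_reduce
  rw [hf s, hf x, hf y, ← EReal.coe_mul, ← EReal.coe_mul, ← EReal.coe_add, EReal.coe_le_coe_iff]
  exact h

/-! ### Closing the cycle of inequalities -/

/-- All four envelopes agree with the scalar envelopes. -/
theorem envelopes_eq {W : SL2 → ℝ} (hobj : IsObjective W) (hiso : IsIsotropic W) {F : SL2} {s : ℝ}
    (hs : s ^ 2 = Complex.normSq (anticonformalPart F.val)) :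
    rankOneEnvelope W F = monotoneConvexEnvelope (fun t => W (shear t)) |s| ∧
    quasiconvexEnvelope W F = monotoneConvexEnvelope (fun t => W (shear t)) |s| ∧
    polyconvexEnvelope W F = monotoneConvexEnvelope (fun t => W (shear t)) |s| ∧
    convexEnvelope W F = monotoneConvexEnvelope (fun t => W (shear t)) |s| ∧
    scalarConvexEnvelope (fun t => W (shear t)) s =
      monotoneConvexEnvelope (fun t => W (shear t)) |s| := by
  have hN : anticonformalNorm F.val = |s| := by
    rw [Complex.normSq_eq_norm_sq] at hs
    rw [anticonformalNorm, ← abs_of_nonneg (norm_nonneg (anticonformalPart F.val))]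
    exact (sq_eq_sq_iff_abs_eq_abs _ _).1 hs.symm
  have hconv : ∀ p : ℝ → ℝ, MonotoneOn p (Ici 0) → ConvexOn ℝ (Ici 0) p →
      IsConvex fun F => (p (anticonformalNorm F) : EReal) := fun p hm hc =>
    isConvex_coe (convexOn_comp_anticonformalNorm hm hc)
  have hC : scalarConvexEnvelope (fun t => W (shear t)) s ≤
      monotoneConvexEnvelope (fun t => W (shear t)) |s| :=
    scalarConvexEnvelope_le_monotoneConvexEnvelope (fun t => apply_shear_abs hobj hiso t) s
  have lowC : monotoneConvexEnvelope (fun t => W (shear t)) |s| ≤ convexEnvelope W F := by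
    rw [← hN]
    exact monotoneConvexEnvelope_le_envelope hobj hiso hconv _
  have lowQ : monotoneConvexEnvelope (fun t => W (shear t)) |s| ≤ quasiconvexEnvelope W F := by
    rw [← hN]
    exact monotoneConvexEnvelope_le_envelope hobj hiso (fun p hm hc =>
      ⟨isQuasiconvex_comp_anticonformalNorm hm hc,
        bddAboveOnCompactsSL_comp_anticonformalNorm hm⟩) _
  have CP : convexEnvelope W F ≤ polyconvexEnvelope W F :=
    envelope_mono_prop (fun w hw => hw.isPolyconvex) _ _
  have PR : polyconvexEnvelope W F ≤ rankOneEnvelope W F :=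
    envelope_mono_prop (fun w hw => hw.isRankOneConvex) _ _
  have upR : rankOneEnvelope W F ≤ scalarConvexEnvelope (fun t => W (shear t)) s := by
    refine sSup_le ?_
    rintro _ ⟨w, hw, hle, rfl⟩
    exact apply_le_scalarConvexEnvelope hobj hiso hle hw.convexAlongShears hs
  have upQ : quasiconvexEnvelope W F ≤ scalarConvexEnvelope (fun t => W (shear t)) s := by
    refine sSup_le ?_
    rintro _ ⟨w, ⟨hw, hb⟩, hle, rfl⟩
    exact apply_le_scalarConvexEnvelope hobj hiso hle
      (hw.convexAlongShears hb (eq_coe_of_le_extendByTop hw.1 hle)) hs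
  -- The cycle is `C_m ≤ CW ≤ PW ≤ RW ≤ Cψ ≤ C_m`; `QW` is squeezed directly between the scalar
  -- envelopes.
  exact ⟨(upR.trans hC).antisymm (lowC.trans (CP.trans PR)), (upQ.trans hC).antisymm lowQ,
    (PR.trans (upR.trans hC)).antisymm (lowC.trans CP),
    (CP.trans (PR.trans (upR.trans hC))).antisymm lowC,
    hC.antisymm (lowC.trans (CP.trans (PR.trans upR)))⟩

end PlanarEnvelopes

open PlanarEnvelopes in
theorem mainTheorem1 (W : SL2 → ℝ) (hobj : IsObjective W) (hiso : IsIsotropic W)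
    (hbdd : ∃ c : ℝ, ∀ F : SL2, c ≤ W F) :
    ∃ ψ φ : ℝ → ℝ,
      RepresentsByDifference W ψ ∧
      (∀ ψ' : ℝ → ℝ, RepresentsByDifference W ψ' → ψ' = ψ) ∧
      RepresentsByMax W φ ∧
      (∀ φ' : ℝ → ℝ, RepresentsByMax W φ' → Set.EqOn φ' φ (Set.Ici 0)) ∧
      ∀ (F : SL2) (a b : ℝ), HasSingularValues F.val a b →
        rankOneEnvelope W F = quasiconvexEnvelope W F ∧
        quasiconvexEnvelope W F = polyconvexEnvelope W F ∧
        polyconvexEnvelope W F = convexEnvelope W F ∧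
        convexEnvelope W F = scalarConvexEnvelope ψ (a - b) ∧
        scalarConvexEnvelope ψ (a - b) = monotoneConvexEnvelope φ (max a b - 1 / max a b) := by
  refine ⟨fun t => W (shear t), fun t => W (shear t), fun F a b h => ?_, fun ψ' hψ' => ?_,
    fun F a b h => ?_, fun φ' hφ' s hs => ?_, fun F a b h => ?_⟩
  · exact apply_eq_shear hobj hiso h.sub_sq.2.2.2
  · funext s
    -- Uniqueness: every real `s` occurs as a difference of singular values, namely those of `shear
    -- s` in a suitable order.
    obtain ⟨a, b, h, rfl⟩ := exists_hasSingularValues_sub_eq (normSq_anticonformalPart_shear s)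
    exact (hψ' _ a b h).symm
  · obtain ⟨h1, ha, hb, hab⟩ := h.sub_sq
    rw [max_sub_one_div_max h1 ha hb]
    exact apply_eq_shear hobj hiso (by rw [sq_abs]; exact hab)
  · obtain ⟨a, b, h, hab⟩ := exists_hasSingularValues_sub_eq (normSq_anticonformalPart_shear s)
    obtain ⟨h1, ha, hb, -⟩ := h.sub_sq
    have := hφ' _ a b h
    rw [max_sub_one_div_max h1 ha hb, hab, abs_of_nonneg hs] at this
    exact this.symm
  · obtain ⟨h1, ha, hb, hab⟩ := h.sub_sq
    rw [max_sub_one_div_max h1 ha hb]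
    obtain ⟨hR, hQ, hP, hC, hS⟩ := envelopes_eq hobj hiso hab
    exact ⟨hR.trans hQ.symm, hQ.trans hP.symm, hP.trans hC.symm, hC.trans hS.symm, hS⟩
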